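/- Let $N$ be a free abelian group of rank $3$, let $M=\operatorname{Hom}(N,\mathbb Z)$ be the dual lattice, and let $k$ be a field. Let $\sigma\subseteq N_{\mathbb R}=N\otimes\mathbb R$ be a strongly convex rational polyhedral cone, and let $X_\sigma=\operatorname{Spec}k[\sigma^\vee\cap M]$ be the associated three-dimensional affine toric variety. If $X_\sigma$ is terminal, $\mathbb Q$-factorial and singular, then $X_\sigma$ does not admit a moderate toric resolution. Here a cone is called nondegenerate if it has dimension $\operatorname{rank}N$. For a strongly convex rational polyhedral cone $\tau$, let $\operatorname{Gen}(\tau)$ be the set of the primitive vectors of $N$ that span the one-dimensional faces of $\tau$; the cone $\tau$ is smooth if $\operatorname{Gen}(\tau)$ is part of a $\mathbb Z$-basis of $N$. A moderate toric resolution of $X_\sigma$ exists only if $\sigma$ is nondegenerate; it is then given by a subdivision $\Sigma$ of $\sigma$ (a finite fan with support $\sigma$) such that every nondegenerate cone $\tau\in\Sigma$ is smooth and the affine hyperplane spanned by $\operatorname{Gen}(\tau)$ intersects every one-dimensional face of $\sigma$. A normal variety is $\mathbb Q$-factorial if each of its Weil divisors has a positive multiple that is Cartier. It is singular if at least one of its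 local rings is not regular. A normal variety $X$ is terminal if $rK_X$ is Cartier for some integer $r>0$, and every exceptional prime divisor $E$ over $X$ (center of codimension at least $2$) has discrepancy $a(E,X)>0$. The discrepancy is $\operatorname{ord}_E(\omega)-\tfrac1r\operatorname{ord}_E(f)$, where $\omega$ is a nonzero rational differential form of top degree with divisor $K_X$, and $f$ is a local equation of $rK_X$ at the center of $E$. (If $k$ is imperfect, it suffices that this holds for those $E$ whose local ring is smooth over $k$.) -/

import Mathlib

open scoped TensorProduct

noncomputable section

namespace ToricModerate

/-! ### Lattices, cones and fans -/

section Cones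

variable {N : Type*} [AddCommGroup N]

/-- The image of a lattice vector `n` in `N_ℝ = ℝ ⊗ N`. -/
def latticePoint (n : N) : ℝ ⊗[ℤ] N := (1 : ℝ) ⊗ₜ[ℤ] n

/-- The `ℝ`-linear extension `N_ℝ → ℝ` of an element `m` of the dual lattice `M = Hom(N, ℤ)`. -/
def realPairing (m : Module.Dual ℤ N) : ℝ ⊗[ℤ] N →ₗ[ℝ] ℝ :=
  Module.Dual.baseChange ℝ m

/-- `σ` is a strongly convex, rational polyhedral cone in `N_ℝ`. -/
def IsLatticeCone (σ : PointedCone ℝ (ℝ ⊗[ℤ] N)) : Prop :=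
  (∃ s : Finset N, σ = PointedCone.hull ℝ (latticePoint '' (s : Set N))) ∧
    ∀ x ∈ σ, -x ∈ σ → x = 0

/-- `σ` is nondegenerate, i.e. of full dimension in `N_ℝ`. -/
def IsNondegenerate (σ : PointedCone ℝ (ℝ ⊗[ℤ] N)) : Prop :=
  Submodule.span ℝ (σ : Set (ℝ ⊗[ℤ] N)) = ⊤

/-- `ρ` is a one-dimensional face of `σ`. -/
def IsRayOf (ρ σ : PointedCone ℝ (ℝ ⊗[ℤ] N)) : Prop :=
  ρ.IsFaceOf σ ∧ Module.finrank ℝ (Submodule.span ℝ (ρ : Set (ℝ ⊗[ℤ] N))) = 1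

/-- `n` is a primitive element of the lattice: `ε n ∉ N` for all `0 < ε < 1`. -/
def IsPrimitive (n : N) : Prop :=
  ∀ ε : ℝ, 0 < ε → ε < 1 → ε • latticePoint n ∉ Set.range (latticePoint (N := N))

/-- `Gen(σ)`: the primitive lattice vectors that span the one-dimensional faces of `σ`. -/
def minimalGenerators (σ : PointedCone ℝ (ℝ ⊗[ℤ] N)) : Set N :=
  {n | IsPrimitive n ∧ (PointedCone.hull ℝ {latticePoint n}).IsFaceOf σ}

/-- `σ` is smooth: its minimal generators are part of a `ℤ`-basis of `N`. -/
def IsSmoothCone (σ : PointedCone ℝ (ℝ ⊗[ℤ] N)) : Prop :=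
  ∃ b : Module.Basis (Fin (Module.finrank ℤ N)) ℤ N, minimalGenerators σ ⊆ Set.range b

/-- `Σ` is a fan in `N_ℝ`. -/
structure IsFan (F : Set (PointedCone ℝ (ℝ ⊗[ℤ] N))) : Prop where
  finite : F.Finite
  isLatticeCone : ∀ τ ∈ F, IsLatticeCone τ
  face_mem : ∀ τ ∈ F, ∀ γ : PointedCone ℝ (ℝ ⊗[ℤ] N), γ.IsFaceOf τ → γ ∈ F
  inf_isFaceOf : ∀ τ ∈ F, ∀ τ' ∈ F, (τ ⊓ τ').IsFaceOf τ ∧ (τ ⊓ τ').IsFaceOf τ'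

/-- `F` is a subdivision of `σ`: a fan whose support is `σ`. -/
def IsSubdivision (F : Set (PointedCone ℝ (ℝ ⊗[ℤ] N))) (σ : PointedCone ℝ (ℝ ⊗[ℤ] N)) : Prop :=
  IsFan F ∧ (⋃ τ ∈ F, (τ : Set (ℝ ⊗[ℤ] N))) = σ

/-- `F` is a moderate toric resolution of the nondegenerate cone `σ`: a subdivision of `σ` each of
whose nondegenerate cones `τ` is smooth and such that the affine hyperplane spanned by `Gen(τ)`
meets every one-dimensional face of `σ`. -/
structure IsModerateToricResolution (F : Set (PointedCone ℝ (ℝ ⊗[ℤ] N)))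
    (σ : PointedCone ℝ (ℝ ⊗[ℤ] N)) : Prop where
  isLatticeCone : IsLatticeCone σ
  nondegenerate : IsNondegenerate σ
  isSubdivision : IsSubdivision F σ
  smooth : ∀ τ ∈ F, IsNondegenerate τ → IsSmoothCone τ
  hyperplane_meets : ∀ τ ∈ F, IsNondegenerate τ →
    ∀ ρ : PointedCone ℝ (ℝ ⊗[ℤ] N), IsRayOf ρ σ →
      ((affineSpan ℝ (latticePoint '' minimalGenerators τ) : Set (ℝ ⊗[ℤ] N)) ∩
        (ρ : Set (ℝ ⊗[ℤ] N))).Nonempty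

/-- The monoid `σ^∨ ∩ M` of the elements of the dual lattice that are nonnegative on `σ`. -/
def dualMonoid (σ : PointedCone ℝ (ℝ ⊗[ℤ] N)) : AddSubmonoid (Module.Dual ℤ N) where
  carrier := {m | ∀ x ∈ σ, 0 ≤ realPairing m x}
  zero_mem' := by
    intro x _
    simp [realPairing]
  add_mem' := by
    intro a b ha hb x hx
    have h : realPairing (a + b) x = realPairing a x + realPairing b x := by
      simp [realPairing]
    rw [h]
    exact add_nonneg (ha x hx) (hb x hx)

/-- The coordinate ring `k[σ^∨ ∩ M]` of the affine toric variety `X_σ = Spec k[σ^∨ ∩ M]`. -/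
abbrev toricRing (k : Type*) [Field k] (σ : PointedCone ℝ (ℝ ⊗[ℤ] N)) :=
  AddMonoidAlgebra k (dualMonoid σ)

instance instIsDomainToricRing (k : Type*) [Field k] (σ : PointedCone ℝ (ℝ ⊗[ℤ] N)) :
    IsDomain (toricRing k σ) := by
  let φ : dualMonoid σ →+ (N → ℤ) :=
    { toFun := fun m n => m.1 n
      map_zero' := by ext; simp
      map_add' := by intro a b; ext; simp }
  have hφ : Function.Injective φ := fun a b h => Subtype.ext (LinearMap.ext (congrFun h))
  have : UniqueSums (dualMonoid σ) := UniqueSums.of_injective_addHom φ.toAddHom hφ inferInstance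
  exact NoZeroDivisors.to_isDomain _

end Cones

/-! ### Singularities of affine varieties

In this section `R` is the coordinate ring of a normal affine variety `X = Spec R` over `k`, and
`FractionRing R` is its function field. -/

section Varieties

/-- A prime divisor over `X = Spec R`, i.e. a prime divisor on some normal variety with a birational
morphism to `X`, given by its local ring `𝒪_{Y,E}`: a discrete valuation ring between `R` and the
function field that is essentially of finite type over `R`. -/
structure DivisorOver (R : Type*) [CommRing R] [IsDomain R] where
  localRing : Subalgebra R (FractionRing R)
  isDVR : IsDiscreteValuationRing localRing
  essFiniteType : Algebra.EssFiniteType R localRing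

attribute [instance] DivisorOver.isDVR

variable {R : Type*} [CommRing R] [IsDomain R]

/-- The center of `E` on `X`, as a prime ideal of `R`. -/
def DivisorOver.center (E : DivisorOver R) : PrimeSpectrum R :=
  PrimeSpectrum.comap (algebraMap R E.localRing) (IsLocalRing.closedPoint E.localRing)

/-- The order of vanishing of a rational function along `E` (only used for nonzero functions). -/
def DivisorOver.ord (E : DivisorOver R) (f : FractionRing R) : ℤ :=
  WithZero.log (Ring.ordFrac E.localRing f)

/-- `E` is exceptional over `X`: its center has codimension at least two. -/
def DivisorOver.IsExceptional (E : DivisorOver R) : Prop := 2 ≤ E.center.asIdeal.height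

variable (R) in
/-- The prime divisors on the normal variety `X`: those divisors over `X` whose center has
codimension one (then the local ring is the localization of `R` at the center). -/
abbrev PrimeDivisor := {E : DivisorOver R // E.center.asIdeal.height = 1}

/-- `f` is a local equation at the point `x` of the divisor with coefficients `D`: the divisor of
`f` and `D` agree on `Spec 𝒪_{X,x}`. -/
def IsLocalEquation (x : PrimeSpectrum R) (D : PrimeDivisor R → ℤ) (f : FractionRing R) : Prop :=
  f ≠ 0 ∧ ∀ E : PrimeDivisor R, E.1.center.asIdeal ≤ x.asIdeal → E.1.ord f = D E

/-- `D` is a Cartier divisor: it is locally principal. -/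
def IsCartier (D : PrimeDivisor R → ℤ) : Prop :=
  ∀ x : PrimeSpectrum R, ∃ f : FractionRing R, IsLocalEquation x D f

variable (R) in
/-- `X = Spec R` is `ℚ`-factorial: it is normal, and every Weil divisor has a positive multiple
that is Cartier. -/
def IsQFactorial : Prop :=
  IsIntegrallyClosed R ∧ ∀ D : PrimeDivisor R →₀ ℤ, ∃ r : ℕ, 0 < r ∧ IsCartier (⇑(r • D))

variable (R) in
/-- `X = Spec R` is singular: some local ring of `X` is not regular. -/
def IsSingular : Prop := ¬ IsRegularRing R

variable (k : Type*) [Field k] [Algebra k R]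

variable (R) in
/-- A basis `B = (β₁, …, β_d)` of the differentials of the function field over `k`. It stands for
the nonzero rational differential form `ω = β₁ ∧ ⋯ ∧ β_d` of top degree. -/
abbrev RationalForm :=
  Module.Basis (Fin (Module.finrank (FractionRing R) (Ω[FractionRing R⁄k]))) (FractionRing R)
    (Ω[FractionRing R⁄k])

variable {k} in
/-- `HasFormOrd E ω n`: the differential form `ω` has order `n` along `E`. That is, the
differentials of the local ring of `E` have a basis `b₁, …, b_d` over the local ring, and
`ω = g • (b₁ ∧ ⋯ ∧ b_d)` with `ord_E g = n`; below, `b₁ ∧ ⋯ ∧ b_d = ω.det b • ω`.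
Over a perfect field such a basis exists for every `E`. If the function field is merely separable
over `k`, as it is for every toric variety, it exists exactly if the local ring is smooth over `k`;
this is so for every prime divisor on an affine toric variety. -/
def HasFormOrd (E : DivisorOver R) (ω : RationalForm R k) (n : ℤ) : Prop :=
  ∃ b : Module.Basis (Fin (Module.finrank (FractionRing R) (Ω[FractionRing R⁄k]))) E.localRing
      (Ω[E.localRing⁄k]),
    n = - E.ord (ω.det fun i => KaehlerDifferential.map k k E.localRing (FractionRing R) (b i))

variable (R) in
/-- `X = Spec R` is terminal: it is normal, the canonical divisor `K = div ω` has a positive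
multiple `rK` that is Cartier, and every exceptional prime divisor `E` over `X` has positive
discrepancy `ord_E ω - (1 / r) ord_E f`, where `f` is a local equation of `rK` at the center
of `E`. -/
def IsTerminal : Prop :=
  IsIntegrallyClosed R ∧
    ∃ (ω : RationalForm R k) (K : PrimeDivisor R → ℤ),
      (∀ E : PrimeDivisor R, HasFormOrd E.1 ω (K E)) ∧
      ∃ r : ℕ, 0 < r ∧ IsCartier (fun E => r * K E) ∧
        ∀ E : DivisorOver R, E.IsExceptional →
          ∀ f : FractionRing R, IsLocalEquation E.center (fun D => r * K D) f →
            ∀ n : ℤ, HasFormOrd E ω n → (0 : ℚ) < n - (E.ord f : ℚ) / r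

end Varieties

end ToricModerate

end

/-! The argument has a combinatorial half and an algebraic half. Suppose a moderate resolution `F`
exists, so that `σ` is nondegenerate.

Combinatorics. Terminality provides an integral functional `ψ` and `r > 0` with `ψ = r` on `Gen(σ)`
and `ψ > r` at all other primitive vectors of `σ` (`exists_functional_of_isTerminal`). Finitely many
proper subspaces cannot cover `σ`, so `F` has a nondegenerate cone `τ`; being smooth, it is
generated by a lattice basis. The sum `l` of the coordinates is `1` on `Gen(τ)`. Its level-one
hyperplane meets every ray of `σ`, so `l` is positive, hence by integrality at least `1`, on
`Gen(σ)`. If `f ∈ Gen(τ)` is written as `∑ c_e e` over `Gen(σ)` with `c_e ≥ 0`, then `∑ c_e ≤ l(f) =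
1`, so `ψ(f) ≤ r` and `f ∈ Gen(σ)` (`minimalGenerators_subset`). By `ℚ`-factoriality each generator
of `σ` is separated from all the others by a functional (`exists_functional_of_isQFactorial`), so
`Gen(σ)` cannot exceed this basis. Thus `σ = τ` is smooth and its ring is a polynomial ring, which
is regular: a contradiction.

Algebra. A primitive `v ∈ σ` gives a divisor `E_v` over `X_σ`, the localization at `X 0` of a
polynomial ring in three characters; there `χ^m` has order `m(v)`, and the form `dlog χ₁ ∧ dlog χ₂ ∧
dlog χ₃` has order `-1`. Both uses of the Cartier condition rest on `hasLinearOrd_of_ord_eq_zero`: a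
rational function whose zeros and poles through the torus-fixed point are all toric has order along
`E_v` linear in `v`. Applied to a local equation of a multiple of `K` or of a toric prime divisor at
that point, this yields the required functionals. -/

noncomputable section

namespace ToricModerate

/-! ### Lattice vectors, primitive vectors and Gordan's alternative -/

section Lattice

variable {N : Type*} [AddCommGroup N]

@[simp]
lemma realPairing_latticePoint (m : Module.Dual ℤ N) (n : N) :
    realPairing m (latticePoint n) = m n := by
  simp [realPairing, latticePoint]

@[simp]
lemma latticePoint_zero : latticePoint (0 : N) = 0 := by simp [latticePoint]

lemma latticePoint_zsmul (z : ℤ) (a : N) : latticePoint (z • a) = (z : ℝ) • latticePoint a := by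
  rw [latticePoint, latticePoint, TensorProduct.tmul_smul, ← Int.cast_smul_eq_zsmul ℝ]

lemma latticePoint_sum {ι : Type*} (s : Finset ι) (f : ι → N) :
    latticePoint (∑ i ∈ s, f i) = ∑ i ∈ s, latticePoint (f i) := by
  simp [latticePoint, TensorProduct.tmul_sum]

lemma isPrimitive_of_dual {n : N} {m : Module.Dual ℤ N} (h : m n = 1) : IsPrimitive n := by
  rintro ε h0 h1 ⟨n', hn'⟩
  have := congrArg (realPairing m) hn'
  rw [map_smul, realPairing_latticePoint, realPairing_latticePoint, h] at this
  simp only [Int.cast_one, smul_eq_mul, mul_one] at this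
  rw [← this] at h0 h1
  norm_cast at h0 h1
  omega

lemma IsPrimitive.ne_zero {n : N} (h : IsPrimitive n) : n ≠ 0 := by
  rintro rfl
  exact h (1 / 2) (by norm_num) (by norm_num) ⟨0, by simp⟩

/-- Perturbation: a multiple of `m` large enough to dominate `x` on the vectors `f i` is added to
`x`. Since `m` vanishes at `t`, the value at `t` remains that of `x`. -/
lemma exists_dual_pos_insert {ι : Type*} (s : Finset ι) (f : ι → N) {t : N}
    {m x : Module.Dual ℤ N} (hm : ∀ i ∈ s, 0 < m (f i)) (ht : m t = 0) (hx : 0 < x t) :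
    ∃ m' : Module.Dual ℤ N, (∀ i ∈ s, 0 < m' (f i)) ∧ 0 < m' t := by
  refine ⟨(1 + ∑ i ∈ s, |x (f i)|) • m + x, fun i hi => ?_, by simpa [ht] using hx⟩
  have h1 : |x (f i)| ≤ ∑ i ∈ s, |x (f i)| :=
    Finset.single_le_sum (f := fun i => |x (f i)|) (fun i _ => abs_nonneg _) hi
  have h2 := neg_abs_le (x (f i))
  have h3 := hm i hi
  simp only [LinearMap.add_apply, LinearMap.smul_apply, smul_eq_mul]
  have h4 : (1 + ∑ i ∈ s, |x (f i)|) * 1 ≤ (1 + ∑ i ∈ s, |x (f i)|) * m (f i) :=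
    mul_le_mul_of_nonneg_left h3 (by linarith [abs_nonneg (x (f i))])
  linarith

variable [Module.Free ℤ N] [Module.Finite ℤ N]

lemma exists_dual_pos {n : N} (hn : n ≠ 0) : ∃ x : Module.Dual ℤ N, 0 < x n := by
  let b := Module.Free.chooseBasis ℤ N
  obtain ⟨i, hi⟩ : ∃ i, b.coord i n ≠ 0 := by
    by_contra! h
    exact hn (b.ext_elem fun i => by simpa using h i)
  rcases lt_or_gt_of_ne hi with h | h
  · exact ⟨-b.coord i, by simpa using h⟩
  · exact ⟨b.coord i, h⟩

lemma latticePoint_injective : Function.Injective (latticePoint (N := N)) := by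
  intro a b h
  by_contra hab
  obtain ⟨x, hx⟩ := exists_dual_pos (sub_ne_zero.2 hab)
  have := congrArg (realPairing x) h
  simp only [realPairing_latticePoint, Int.cast_inj] at this
  simp [this] at hx

/-- Every nonzero lattice vector is a positive multiple of one on which a functional is `1`. -/
lemma exists_eq_nsmul_of_ne_zero {n : N} (hn : n ≠ 0) :
    ∃ (d : ℤ) (n' : N) (m : Module.Dual ℤ N), 0 < d ∧ n = d • n' ∧ m n' = 1 := by
  let b := Module.Free.chooseBasis ℤ N
  let ev : Module.Dual ℤ N →ₗ[ℤ] ℤ := Module.Dual.eval ℤ N n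
  -- `d` generates the ideal of all values of functionals at `n`; up to sign it is the content of
  -- `n`.
  obtain ⟨d, hd⟩ := (IsPrincipalIdealRing.principal (LinearMap.range ev)).principal
  have hdvd : ∀ m : Module.Dual ℤ N, d ∣ m n := by
    intro m
    have : m n ∈ LinearMap.range ev := ⟨m, rfl⟩
    rw [hd] at this
    exact Ideal.mem_span_singleton.1 this
  obtain ⟨m, hm⟩ : d ∈ LinearMap.range ev := by
    rw [hd]; exact Submodule.mem_span_singleton_self d
  have hm' : m n = d := hm
  have hd0 : d ≠ 0 := by
    rintro rfl
    obtain ⟨x, hx⟩ := exists_dual_pos hn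
    have := hdvd x
    rw [zero_dvd_iff] at this
    omega
  choose c hc using fun i => hdvd (b.coord i)
  have key : n = d • ∑ i, c i • b i := by
    conv_lhs => rw [← b.sum_repr n]
    rw [Finset.smul_sum]
    refine Finset.sum_congr rfl fun i _ => ?_
    rw [smul_smul, ← hc i]
    rfl
  have h1 : m (∑ i, c i • b i) = 1 := by
    have : m n = d * m (∑ i, c i • b i) := by
      conv_lhs => rw [key]
      rw [map_smul, smul_eq_mul]
    rw [hm'] at this
    exact (mul_eq_left₀ hd0).1 this.symm
  rcases lt_or_gt_of_ne hd0 with h | h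
  · exact ⟨-d, -∑ i, c i • b i, -m, by omega, by simpa using key, by simpa using h1⟩
  · exact ⟨d, _, m, h, key, h1⟩

lemma IsPrimitive.exists_dual {n : N} (h : IsPrimitive n) : ∃ m : Module.Dual ℤ N, m n = 1 := by
  obtain ⟨d, n', m, hd, hn, hm⟩ := exists_eq_nsmul_of_ne_zero h.ne_zero
  have hd1 : d = 1 := by
    by_contra hne
    have hd2 : (1 : ℝ) < d := by exact_mod_cast (by omega : 1 < d)
    refine h (d : ℝ)⁻¹ (by positivity) (inv_lt_one_of_one_lt₀ hd2) ⟨n', ?_⟩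
    rw [hn, latticePoint_zsmul, smul_smul, inv_mul_cancel₀ (by positivity), one_smul]
  exact ⟨m, by rw [hn, hd1, one_smul, hm]⟩

lemma IsPrimitive.eq_of_smul {a b : N} (ha : IsPrimitive a) (hb : IsPrimitive b) {r : ℝ}
    (hr : 0 < r) (h : latticePoint a = r • latticePoint b) : a = b := by
  rcases lt_trichotomy r 1 with h1 | rfl | h1
  · exact absurd ⟨a, h⟩ (hb r hr h1)
  · exact latticePoint_injective (by simpa using h)
  · refine absurd ⟨b, ?_⟩ (ha r⁻¹ (by positivity) (inv_lt_one_of_one_lt₀ h1))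
    rw [h, smul_smul, inv_mul_cancel₀ hr.ne', one_smul]

/-- **Gordan's theorem of the alternative** for lattice vectors. -/
theorem gordan_alternative {ι : Type*} (s : Finset ι) : ∀ f : ι → N,
    (∃ m : Module.Dual ℤ N, ∀ i ∈ s, 0 < m (f i)) ∨
      ∃ c : ι → ℤ, (∀ i, 0 ≤ c i) ∧ (∃ i ∈ s, 0 < c i) ∧ ∑ i ∈ s, c i • f i = 0 := by
  classical
  induction s using Finset.induction_on with
  | empty => intro f; exact Or.inl ⟨0, by simp⟩
  | insert a s ha ih =>
    intro f
    have extend : ∀ (c : ι → ℤ) (z : ℤ), (∑ i ∈ insert a s, Function.update c a z i • f i) =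
        z • f a + ∑ i ∈ s, c i • f i := by
      intro c z
      rw [Finset.sum_insert ha, Function.update_self]
      congr 1
      refine Finset.sum_congr rfl fun i hi => ?_
      rw [Function.update_of_ne (by rintro rfl; exact ha hi)]
    have nonneg : ∀ (c : ι → ℤ) (z : ℤ), (∀ i, 0 ≤ c i) → 0 ≤ z →
        ∀ i, 0 ≤ Function.update c a z i := by
      intro c z hc hz i
      by_cases h : i = a
      · subst h; simpa using hz
      · simpa [h] using hc i
    have posmem : ∀ (c : ι → ℤ) (z : ℤ), (∃ i ∈ s, 0 < c i) →
        ∃ i ∈ insert a s, 0 < Function.update c a z i := by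
      rintro c z ⟨i, hi, h⟩
      refine ⟨i, Finset.mem_insert_of_mem hi, ?_⟩
      rwa [Function.update_of_ne (by rintro rfl; exact ha hi)]
    by_cases ht : f a = 0
    · refine Or.inr ⟨Function.update 0 a 1, nonneg 0 1 (fun _ => le_rfl) (by norm_num),
        ⟨a, by simp, by simp⟩, ?_⟩
      rw [extend]; simp [ht]
    obtain ⟨x, hx⟩ := exists_dual_pos ht
    rcases ih f with ⟨m, hm⟩ | ⟨c, hc, hpos, hsum⟩
    · rcases lt_trichotomy (m (f a)) 0 with hneg | hzero | hpos
      -- Elimination of `f a`: these vectors are positive multiples of the projections of the `f i`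
      -- to `ker m` along `f a`. A functional positive on them is corrected by `m` so as to vanish
      -- at `f a`, and then perturbed; a relation among them is a relation among the original
      -- vectors, with `f a` receiving the coefficient `∑ c i * m (f i) ≥ 0`.
      · rcases ih (fun i => (-(m (f a))) • f i + m (f i) • f a) with ⟨m', hm'⟩ | ⟨c, hc, hpos, hsum⟩
        · obtain ⟨m'', h1, h2⟩ := exists_dual_pos_insert s f (t := f a)
            (m := (-(m (f a))) • m' + m' (f a) • m) (fun i hi => by
              have := hm' i hi
              simp only [map_add, map_smul, smul_eq_mul] at this
              simp only [LinearMap.add_apply, LinearMap.smul_apply, smul_eq_mul]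
              linarith) (by simp; ring) hx
          exact Or.inl ⟨m'', by simpa [h2] using h1⟩
        · obtain ⟨j, hj, hcj⟩ := hpos
          refine Or.inr ⟨Function.update (fun i => c i * (-(m (f a)))) a (∑ i ∈ s, c i * m (f i)),
            nonneg _ _ (fun i => mul_nonneg (hc i) (by omega))
              (Finset.sum_nonneg fun i hi => mul_nonneg (hc i) (hm i hi).le),
            posmem _ _ ⟨j, hj, mul_pos hcj (by omega)⟩, ?_⟩
          rw [extend, ← hsum, Finset.sum_smul, ← Finset.sum_add_distrib]
          refine Finset.sum_congr rfl fun i _ => ?_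
          module
      · obtain ⟨m', h1, h2⟩ := exists_dual_pos_insert s f hm hzero hx
        exact Or.inl ⟨m', by simpa [h2] using h1⟩
      · exact Or.inl ⟨m, by simpa [hpos] using hm⟩
    · exact Or.inr ⟨Function.update c a 0, nonneg c 0 hc le_rfl, posmem c 0 hpos, by
        rw [extend, hsum]; simp⟩

end Lattice

/-! ### Generators of a strongly convex cone and the functionals exposing them -/

section ConeGenerators

variable {N : Type*} [AddCommGroup N]

lemma smul_mem_cone {σ : PointedCone ℝ (ℝ ⊗[ℤ] N)} {x : ℝ ⊗[ℤ] N} {c : ℝ} (hc : 0 ≤ c)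
    (hx : x ∈ σ) : c • x ∈ σ :=
  PointedCone.smul_mem σ hc hx

lemma mem_hull_latticePoint {T : Finset N} {x : ℝ ⊗[ℤ] N} :
    x ∈ PointedCone.hull ℝ (latticePoint '' (T : Set N)) ↔
      ∃ c : N → ℝ, (∀ n, 0 ≤ c n) ∧ x = ∑ n ∈ T, c n • latticePoint n := by
  classical
  constructor
  · intro hx
    induction hx using Submodule.span_induction with
    | mem x hx =>
      obtain ⟨n, hn, rfl⟩ := hx
      refine ⟨fun i => if i = n then 1 else 0, fun i => by positivity, ?_⟩
      simp [Finset.mem_coe.1 hn]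
    | zero => exact ⟨0, by simp, by simp⟩
    | add x y _ _ hx hy =>
      obtain ⟨c, hc, rfl⟩ := hx
      obtain ⟨d, hd, rfl⟩ := hy
      exact ⟨c + d, fun n => add_nonneg (hc n) (hd n), by
        simp [add_smul, Finset.sum_add_distrib]⟩
    | smul a x _ hx =>
      obtain ⟨c, hc, rfl⟩ := hx
      refine ⟨fun n => a.1 * c n, fun n => mul_nonneg a.2 (hc n), ?_⟩
      simp only [mul_smul, ← Finset.smul_sum]
      rfl
  · rintro ⟨c, hc, rfl⟩
    exact Submodule.sum_mem _ fun n hn => smul_mem_cone (hc n) (Submodule.subset_span ⟨n, hn, rfl⟩)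

lemma mem_hull_singleton {x y : ℝ ⊗[ℤ] N} :
    x ∈ PointedCone.hull ℝ {y} ↔ ∃ c : ℝ, 0 ≤ c ∧ x = c • y := by
  rw [Submodule.mem_span_singleton]
  constructor
  · rintro ⟨a, rfl⟩; exact ⟨a.1, a.2, rfl⟩
  · rintro ⟨c, hc, rfl⟩; exact ⟨⟨c, hc⟩, rfl⟩

lemma realPairing_sum_smul (m : Module.Dual ℤ N) (T : Finset N) (c : N → ℝ) :
    realPairing m (∑ n ∈ T, c n • latticePoint n) = ∑ n ∈ T, c n * m n := by
  simp

/-- If a nonnegative functional on the generators vanishes at a point of the cone, then the point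
only involves generators on which the functional vanishes. -/
lemma coeff_eq_zero_of_pairing_eq_zero {T : Finset N} {c : N → ℝ} (hc : ∀ n, 0 ≤ c n)
    {m : Module.Dual ℤ N} (hm : ∀ n ∈ T, 0 ≤ m n)
    (h : realPairing m (∑ n ∈ T, c n • latticePoint n) = 0) {n : N} (hn : n ∈ T)
    (hpos : 0 < m n) : c n = 0 := by
  rw [realPairing_sum_smul, Finset.sum_eq_zero_iff_of_nonneg] at h
  · have := h n hn
    have hne : (m n : ℝ) ≠ 0 := by exact_mod_cast hpos.ne'
    exact (mul_eq_zero.1 this).resolve_right hne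
  · intro i hi
    exact mul_nonneg (hc i) (by exact_mod_cast hm i hi)

lemma eq_zero_of_sum_eq_zero {σ : PointedCone ℝ (ℝ ⊗[ℤ] N)} (hσ : ∀ x ∈ σ, -x ∈ σ → x = 0)
    {ι : Type*} (s : Finset ι) (f : ι → ℝ ⊗[ℤ] N) (hf : ∀ i ∈ s, f i ∈ σ)
    (h : ∑ i ∈ s, f i = 0) {i : ι} (hi : i ∈ s) : f i = 0 := by
  classical
  refine hσ _ (hf i hi) ?_
  rw [← Finset.add_sum_erase s f hi] at h
  rw [neg_eq_of_add_eq_zero_right h]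
  exact Submodule.sum_mem _ fun j hj => hf j (Finset.mem_of_mem_erase hj)

variable [Module.Free ℤ N] [Module.Finite ℤ N]

lemma latticePoint_ne_zero {n : N} (hn : n ≠ 0) : latticePoint n ≠ 0 := by
  rw [← latticePoint_zero]; exact latticePoint_injective.ne hn

/-- In the other case of Gordan's alternative, a nontrivial nonnegative combination of the
generators vanishes, against strong convexity. -/
lemma exists_interior_functional {σ : PointedCone ℝ (ℝ ⊗[ℤ] N)}
    (hσ : ∀ x ∈ σ, -x ∈ σ → x = 0) {T : Finset N} (h0 : ∀ e ∈ T, e ≠ 0)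
    (hT : σ = PointedCone.hull ℝ (latticePoint '' (T : Set N))) :
    ∃ m : Module.Dual ℤ N, ∀ e ∈ T, 0 < m e := by
  rcases gordan_alternative T id with h | ⟨c, hc, ⟨i, hi, hci⟩, hsum⟩
  · exact h
  · exfalso
    have hs : ∑ n ∈ T, (c n : ℝ) • latticePoint n = 0 := by
      simpa [latticePoint_sum, latticePoint_zsmul] using congrArg latticePoint hsum
    have := eq_zero_of_sum_eq_zero hσ T _ (fun n hn => smul_mem_cone (by exact_mod_cast hc n)
      (hT ▸ Submodule.subset_span ⟨n, hn, rfl⟩)) hs hi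
    rw [smul_eq_zero] at this
    rcases this with h | h
    · have : c i = 0 := by exact_mod_cast h
      omega
    · exact latticePoint_ne_zero (h0 i hi) h

/-- Gordan's alternative modulo `e`: the other generators are projected along `e` to `ker μ`, where
`μ e = 1`. A positive relation there lifts to `∑ c n • n = z • e` over the generators other than
`e`. -/
lemma exists_exposing_functional {σ : PointedCone ℝ (ℝ ⊗[ℤ] N)}
    (hσ : ∀ x ∈ σ, -x ∈ σ → x = 0) {T : Finset N} (hprim : ∀ e ∈ T, IsPrimitive e)
    (hT : σ = PointedCone.hull ℝ (latticePoint '' (T : Set N)))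
    {e : N} (he : e ∈ T)
    (hmin : latticePoint e ∉ PointedCone.hull ℝ (latticePoint '' ((T : Set N) \ {e}))) :
    ∃ m : Module.Dual ℤ N, m e = 0 ∧ ∀ e' ∈ T, e' ≠ e → 0 < m e' := by
  classical
  obtain ⟨μ, hμ⟩ := (hprim e he).exists_dual
  rcases gordan_alternative (T.erase e) (fun f => f - μ f • e) with
    ⟨m, hm⟩ | ⟨c, hc, ⟨i, hi, hci⟩, hsum⟩
  · refine ⟨m - m e • μ, by simp [hμ], fun e' he' hne => ?_⟩
    have := hm e' (Finset.mem_erase.2 ⟨hne, he'⟩)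
    simp only [map_sub, map_smul, smul_eq_mul] at this
    simp only [LinearMap.sub_apply, LinearMap.smul_apply, smul_eq_mul]
    linarith
  · exfalso
    set z := ∑ n ∈ T.erase e, c n * μ n with hz
    have h1 : ∑ n ∈ T.erase e, c n • n = z • e := by
      simp only [smul_sub, Finset.sum_sub_distrib, smul_smul] at hsum
      rw [sub_eq_zero] at hsum
      rw [hsum, hz, Finset.sum_smul]
    have h2 : ∑ n ∈ T.erase e, (c n : ℝ) • latticePoint n = (z : ℝ) • latticePoint e := by
      simpa [latticePoint_sum, latticePoint_zsmul] using congrArg latticePoint h1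
    have hmem : ∀ n ∈ T, latticePoint n ∈ σ := fun n hn => hT ▸ Submodule.subset_span ⟨n, hn, rfl⟩
    -- For `z ≤ 0` the relation contradicts strong convexity; for `z > 0` it puts `e` in the cone of
    -- the other generators.
    rcases le_or_gt z 0 with hz0 | hz0
    · have h3 : ∑ n ∈ T, (Function.update (fun n => (c n : ℝ)) e (-(z : ℝ)) n) • latticePoint n
          = 0 := by
        rw [← Finset.add_sum_erase T _ he, Function.update_self]
        have : ∑ n ∈ T.erase e, (Function.update (fun n => (c n : ℝ)) e (-(z : ℝ)) n) •
            latticePoint n = ∑ n ∈ T.erase e, (c n : ℝ) • latticePoint n :=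
          Finset.sum_congr rfl fun n hn => by
            rw [Function.update_of_ne (Finset.ne_of_mem_erase hn)]
        rw [this, h2]; module
      have h4 := eq_zero_of_sum_eq_zero hσ T _ (fun n hn => smul_mem_cone (by
        by_cases hne : n = e
        · subst hne; simpa using hz0
        · rw [Function.update_of_ne hne]; exact_mod_cast hc n) (hmem n hn)) h3
        (Finset.mem_of_mem_erase hi)
      rw [Function.update_of_ne (Finset.ne_of_mem_erase hi), smul_eq_zero] at h4
      rcases h4 with h | h
      · have : c i = 0 := by exact_mod_cast h
        omega
      · exact latticePoint_ne_zero (hprim i (Finset.mem_of_mem_erase hi)).ne_zero h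
    · apply hmin
      have hzR : (0 : ℝ) < z := by exact_mod_cast hz0
      have h3 : latticePoint e = (z : ℝ)⁻¹ • ∑ n ∈ T.erase e, (c n : ℝ) • latticePoint n := by
        rw [h2, smul_smul, inv_mul_cancel₀ hzR.ne', one_smul]
      rw [h3]
      refine smul_mem_cone (by positivity) (Submodule.sum_mem _ fun n hn =>
        smul_mem_cone (by exact_mod_cast hc n) (Submodule.subset_span ⟨n, ?_, rfl⟩))
      exact ⟨Finset.mem_of_mem_erase hn, Finset.ne_of_mem_erase hn⟩

lemma exists_primitive_hull_eq (s : Finset N) : ∃ T : Finset N, (∀ e ∈ T, IsPrimitive e) ∧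
    PointedCone.hull ℝ (latticePoint '' (T : Set N)) =
      PointedCone.hull ℝ (latticePoint '' (s : Set N)) := by
  classical
  have key : ∀ n : N, ∃ (n' : N), n ≠ 0 → IsPrimitive n' ∧ ∃ d : ℤ, 0 < d ∧ n = d • n' := by
    intro n
    by_cases hn : n = 0
    · exact ⟨0, fun h => absurd hn h⟩
    · obtain ⟨d, n', m, hd, h1, h2⟩ := exists_eq_nsmul_of_ne_zero hn
      exact ⟨n', fun _ => ⟨isPrimitive_of_dual h2, d, hd, h1⟩⟩
  choose p hp using key
  refine ⟨(s.filter (· ≠ 0)).image p, ?_, le_antisymm ?_ ?_⟩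
  · intro e he
    obtain ⟨n, hn, rfl⟩ := Finset.mem_image.1 he
    exact (hp n (Finset.mem_filter.1 hn).2).1
  · rw [Submodule.span_le]
    rintro _ ⟨e, he, rfl⟩
    obtain ⟨n, hn, rfl⟩ := Finset.mem_image.1 (Finset.mem_coe.1 he)
    obtain ⟨hns, hn0⟩ := Finset.mem_filter.1 hn
    obtain ⟨-, d, hd, hnd⟩ := hp n hn0
    have hdR : (0 : ℝ) < d := by exact_mod_cast hd
    have : latticePoint (p n) = (d : ℝ)⁻¹ • latticePoint n := by
      conv_rhs => rw [hnd]
      rw [latticePoint_zsmul, smul_smul, inv_mul_cancel₀ hdR.ne', one_smul]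
    rw [this]
    exact smul_mem_cone (by positivity) (Submodule.subset_span ⟨n, hns, rfl⟩)
  · rw [Submodule.span_le]
    rintro _ ⟨n, hn, rfl⟩
    by_cases hn0 : n = 0
    · subst hn0; simp
    · obtain ⟨-, d, hd, hnd⟩ := hp n hn0
      rw [hnd, latticePoint_zsmul]
      refine smul_mem_cone (by exact_mod_cast hd.le) (Submodule.subset_span ⟨p n, ?_, rfl⟩)
      exact Finset.mem_coe.2 (Finset.mem_image_of_mem p (Finset.mem_filter.2 ⟨hn, hn0⟩))

/-- The generators of a strongly convex rational polyhedral cone, together with functionals that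
expose the rays and one that is positive on the cone. -/
theorem IsLatticeCone.exists_generators {σ : PointedCone ℝ (ℝ ⊗[ℤ] N)} (hσ : IsLatticeCone σ) :
    ∃ T : Finset N, minimalGenerators σ = T ∧
      σ = PointedCone.hull ℝ (latticePoint '' (T : Set N)) ∧
      (∀ e ∈ T, ∃ m : Module.Dual ℤ N, m e = 0 ∧ ∀ e' ∈ T, e' ≠ e → 0 < m e') ∧
      ∃ m : Module.Dual ℤ N, ∀ e ∈ T, 0 < m e := by
  classical
  obtain ⟨⟨s, hs⟩, hsc⟩ := hσ
  obtain ⟨T₀, hprim₀, hT₀⟩ := exists_primitive_hull_eq s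
  -- A generating set of primitive vectors that is minimal under inclusion; minimality says that no
  -- `e ∈ T` lies in the cone of the others.
  obtain ⟨T, hTsub, hT⟩ := exists_minimal_le_of_wellFoundedLT
    (fun T : Finset N => (∀ e ∈ T, IsPrimitive e) ∧
      PointedCone.hull ℝ (latticePoint '' (T : Set N)) = σ) T₀ ⟨hprim₀, hT₀.trans hs.symm⟩
  have hprim := hT.prop.1
  have hTσ := hT.prop.2.symm
  have hmin : ∀ e ∈ T,
      latticePoint e ∉ PointedCone.hull ℝ (latticePoint '' ((T : Set N) \ {e})) := by
    intro e he hmem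
    have h1 : PointedCone.hull ℝ (latticePoint '' ((T.erase e : Finset N) : Set N)) = σ := by
      rw [Finset.coe_erase]
      refine le_antisymm (hTσ ▸ Submodule.span_mono (Set.image_mono Set.sdiff_subset)) ?_
      rw [hTσ, Submodule.span_le]
      rintro _ ⟨n, hn, rfl⟩
      by_cases hne : n = e
      · subst hne; exact hmem
      · exact Submodule.subset_span ⟨n, ⟨hn, hne⟩, rfl⟩
    have := hT.le_of_le ⟨fun e' he' => hprim e' (Finset.mem_of_mem_erase he'), h1⟩
      (Finset.erase_subset e T)
    exact Finset.notMem_erase e T (this he)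
  have hexp := fun e he => exists_exposing_functional hsc hprim hTσ (e := e) he (hmin e he)
  refine ⟨T, Set.ext fun n => ⟨fun ⟨hn, hface⟩ => ?_, fun hn => ⟨hprim n hn, ?_, ?_⟩⟩, hTσ, hexp,
    exists_interior_functional hsc (fun e he => (hprim e he).ne_zero) hTσ⟩
  · have hmem : latticePoint n ∈ PointedCone.hull ℝ (latticePoint '' (T : Set N)) :=
      hTσ ▸ hface.le (Submodule.subset_span rfl)
    obtain ⟨c, hc, hsum⟩ := mem_hull_latticePoint.1 hmem
    obtain ⟨e, he, hce⟩ : ∃ e ∈ T, c e ≠ 0 := by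
      by_contra! h
      refine latticePoint_ne_zero hn.ne_zero ?_
      rw [hsum, Finset.sum_eq_zero fun i hi => by rw [h i hi, zero_smul]]
    have hmemT : ∀ e ∈ T, latticePoint e ∈ σ := fun e he =>
      hTσ ▸ Submodule.subset_span ⟨e, he, rfl⟩
    -- `e` occurs in `n` with positive coefficient, so the face spanned by `n` contains it; two
    -- primitive vectors on one ray coincide.
    have hein : latticePoint e ∈ PointedCone.hull ℝ {latticePoint n} := by
      refine hface.mem_of_smul_add_mem (y := ∑ i ∈ T.erase e, c i • latticePoint i) (hmemT e he)
        (Submodule.sum_mem _ fun i hi =>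
        smul_mem_cone (hc i) (hmemT i (Finset.mem_of_mem_erase hi)))
        (lt_of_le_of_ne (hc e) hce.symm) ?_
      rw [Finset.add_sum_erase T (fun i => c i • latticePoint i) he, ← hsum]
      exact Submodule.subset_span rfl
    obtain ⟨r, hr, her⟩ := mem_hull_singleton.1 hein
    have hr0 : r ≠ 0 := by
      rintro rfl
      exact latticePoint_ne_zero (hprim e he).ne_zero (by simpa using her)
    rw [← (hprim e he).eq_of_smul hn (lt_of_le_of_ne hr hr0.symm) her]
    exact he
  · rw [Submodule.span_le, Set.singleton_subset_iff, hTσ]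
    exact Submodule.subset_span ⟨n, hn, rfl⟩
  · intro x y a hx hy ha hxy
    obtain ⟨m, hmn, hm⟩ := hexp n hn
    have hm' : ∀ e ∈ T, 0 ≤ m e := fun e he => by
      by_cases h : e = n
      · rw [h, hmn]
      · exact (hm e he h).le
    rw [hTσ, mem_hull_latticePoint] at hx hy
    obtain ⟨c, hc, rfl⟩ := hx
    obtain ⟨d, hd, rfl⟩ := hy
    obtain ⟨r, hr, hxy⟩ := mem_hull_singleton.1 hxy
    have h1 : 0 ≤ realPairing m (∑ n ∈ T, c n • latticePoint n) := by
      rw [realPairing_sum_smul]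
      exact Finset.sum_nonneg fun i hi => mul_nonneg (hc i) (by exact_mod_cast hm' i hi)
    have h2 : 0 ≤ realPairing m (∑ n ∈ T, d n • latticePoint n) := by
      rw [realPairing_sum_smul]
      exact Finset.sum_nonneg fun i hi => mul_nonneg (hd i) (by exact_mod_cast hm' i hi)
    have h3 := congrArg (realPairing m) hxy
    rw [map_add, map_smul, map_smul, realPairing_latticePoint, hmn, Int.cast_zero, smul_zero,
      smul_eq_mul] at h3
    have h4 : realPairing m (∑ n ∈ T, c n • latticePoint n) = 0 := by
      have h5 := mul_nonneg ha.le h1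
      have : a * realPairing m (∑ n ∈ T, c n • latticePoint n) = 0 := by linarith
      exact (mul_eq_zero.1 this).resolve_left ha.ne'
    refine mem_hull_singleton.2 ⟨c n, hc n, ?_⟩
    refine Finset.sum_eq_single_of_mem n hn fun e he hne => ?_
    rw [coeff_eq_zero_of_pairing_eq_zero hc hm' h4 he (hm e he hne), zero_smul]

end ConeGenerators

/-! ### The dual monoid -/

section DualMonoid

variable {N : Type*} [AddCommGroup N] {σ : PointedCone ℝ (ℝ ⊗[ℤ] N)} {T : Finset N}

lemma latticePoint_mem_of_mem (hT : σ = PointedCone.hull ℝ (latticePoint '' (T : Set N)))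
    {e : N} (he : e ∈ T) : latticePoint e ∈ σ :=
  hT ▸ Submodule.subset_span ⟨e, he, rfl⟩

lemma nonneg_of_mem_dualMonoid {m : Module.Dual ℤ N} (hm : m ∈ dualMonoid σ) {v : N}
    (hv : latticePoint v ∈ σ) : 0 ≤ m v := by
  have h : 0 ≤ realPairing m (latticePoint v) := hm _ hv
  rw [realPairing_latticePoint] at h
  exact_mod_cast h

lemma mem_dualMonoid_iff (hT : σ = PointedCone.hull ℝ (latticePoint '' (T : Set N)))
    {m : Module.Dual ℤ N} : m ∈ dualMonoid σ ↔ ∀ e ∈ T, 0 ≤ m e := by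
  refine ⟨fun h e he => nonneg_of_mem_dualMonoid h (latticePoint_mem_of_mem hT he), fun h x hx => ?_⟩
  rw [hT] at hx
  obtain ⟨c, hc, rfl⟩ := mem_hull_latticePoint.1 hx
  rw [realPairing_sum_smul]
  exact Finset.sum_nonneg fun i hi => mul_nonneg (hc i) (by exact_mod_cast h i hi)

/-- The combinatorial form of localization: inverting `χ^m` leaves only the conditions at the
generators where `m` vanishes. -/
lemma exists_add_nsmul_mem_dualMonoid
    (hT : σ = PointedCone.hull ℝ (latticePoint '' (T : Set N))) {m a : Module.Dual ℤ N}
    (hm : ∀ e ∈ T, 0 ≤ m e) (ha : ∀ e ∈ T, m e = 0 → 0 ≤ a e) :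
    ∃ n : ℕ, a + n • m ∈ dualMonoid σ := by
  refine ⟨∑ e ∈ T, (a e).natAbs, (mem_dualMonoid_iff hT).2 fun e he => ?_⟩
  simp only [LinearMap.add_apply, LinearMap.smul_apply, nsmul_eq_mul]
  rcases (hm e he).eq_or_lt with h | h
  · rw [← h, mul_zero, add_zero]; exact ha e he h.symm
  · have h1 : (a e).natAbs ≤ ∑ e ∈ T, (a e).natAbs :=
      Finset.single_le_sum (f := fun e => (a e).natAbs) (fun i _ => Nat.zero_le _) he
    have h2 : ((a e).natAbs : ℤ) ≤ ((∑ e ∈ T, (a e).natAbs : ℕ) : ℤ) := by exact_mod_cast h1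
    have h3 : ((∑ e ∈ T, (a e).natAbs : ℕ) : ℤ) * 1 ≤
        ((∑ e ∈ T, (a e).natAbs : ℕ) : ℤ) * m e :=
      mul_le_mul_of_nonneg_left h (Int.natCast_nonneg _)
    omega

variable [Module.Free ℤ N] [Module.Finite ℤ N]

/-- A primitive vector of the cone that is not one of its generators has a generator in the relative
interior of the smallest face containing it, and lies off the ray of that generator. -/
lemma exists_generator_of_notMem (hT : σ = PointedCone.hull ℝ (latticePoint '' (T : Set N)))
    (hgen : minimalGenerators σ = T)
    (hexp : ∀ e ∈ T, ∃ m : Module.Dual ℤ N, m e = 0 ∧ ∀ e' ∈ T, e' ≠ e → 0 < m e')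
    {v : N} (hv : IsPrimitive v) (hvσ : latticePoint v ∈ σ) (hvT : v ∉ T) :
    ∃ e ∈ T, (∀ m ∈ dualMonoid σ, m v = 0 → m e = 0) ∧
      ∃ m ∈ dualMonoid σ, m e = 0 ∧ 0 < m v := by
  have hvσ' := hvσ
  rw [hT, mem_hull_latticePoint] at hvσ'
  obtain ⟨c, hc, hsum⟩ := hvσ'
  obtain ⟨e, he, hce⟩ : ∃ e ∈ T, c e ≠ 0 := by
    by_contra! h
    refine latticePoint_ne_zero hv.ne_zero ?_
    rw [hsum, Finset.sum_eq_zero fun i hi => by rw [h i hi, zero_smul]]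
  refine ⟨e, he, fun m hm hmv => ?_, ?_⟩
  · by_contra hne
    have h0 := (mem_dualMonoid_iff hT).1 hm
    exact hce (coeff_eq_zero_of_pairing_eq_zero hc h0
      (by rw [← hsum, realPairing_latticePoint, hmv, Int.cast_zero]) he
      (lt_of_le_of_ne (h0 e he) (Ne.symm hne)))
  · obtain ⟨m, hme, hm⟩ := hexp e he
    have hm' : ∀ e ∈ T, 0 ≤ m e := fun i hi => by
      by_cases h : i = e
      · rw [h, hme]
      · exact (hm i hi h).le
    have hmd := (mem_dualMonoid_iff hT).2 hm'
    refine ⟨m, hmd, hme, lt_of_le_of_ne (nonneg_of_mem_dualMonoid hmd hvσ) fun h0 => hvT ?_⟩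
    have hv' : latticePoint v = c e • latticePoint e := by
      rw [hsum]
      refine Finset.sum_eq_single_of_mem e he fun i hi hne => ?_
      rw [coeff_eq_zero_of_pairing_eq_zero hc hm'
        (by rw [← hsum, realPairing_latticePoint, ← h0, Int.cast_zero]) hi (hm i hi hne), zero_smul]
    have hep : IsPrimitive e := by
      have : e ∈ minimalGenerators σ := hgen ▸ he
      exact this.1
    rw [hv.eq_of_smul hep (lt_of_le_of_ne (hc e) hce.symm) hv']
    exact he

end DualMonoid

/-! ### Existence of a nondegenerate cone in a subdivision -/

section Subdivision

variable {V : Type*} [AddCommGroup V] [Module ℝ V]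

/-- A full-dimensional cone covered by finitely many subspaces lies in one of them. -/
lemma exists_eq_top_of_cone_subset {n : ℕ} (b : Module.Basis (Fin n) ℝ V)
    (C : PointedCone ℝ V) (hb : ∀ i, b i ∈ C) {ι : Type*} (s : Set ι) (hs : s.Finite)
    (W : ι → Submodule ℝ V) (h : ∀ x ∈ C, ∃ i ∈ s, x ∈ W i) : ∃ i ∈ s, W i = ⊤ := by
  by_contra! hne
  have hφ : ∀ i : s, ∃ φ : V →ₗ[ℝ] ℝ, φ ≠ 0 ∧ W i.1 ≤ LinearMap.ker φ := fun i =>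
    Submodule.exists_le_ker_of_lt_top _ (hne i i.2).lt_top
  choose φ hφ0 hφ using hφ
  -- The points `∑ t ^ j • b j`, `t > 0`, of a moment curve lie in the cone, and on this curve a
  -- nonzero functional is a nonzero polynomial in `t`. Some `t` avoids the roots of all of them.
  let p : s → Polynomial ℝ := fun i => ∑ j : Fin n, Polynomial.monomial (j : ℕ) (φ i (b j))
  have hp0 : ∀ i, p i ≠ 0 := by
    intro i hi
    refine hφ0 i (b.ext fun j => ?_)
    have := congrArg (fun q => Polynomial.coeff q (j : ℕ)) hi
    simpa [p, Polynomial.finsetSum_coeff, Polynomial.coeff_monomial, Fin.val_inj] using this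
  have := hs.fintype
  have hfin : (⋃ i : s, {t : ℝ | (p i).IsRoot t}).Finite :=
    Set.finite_iUnion fun i => Polynomial.finite_setOfPred_isRoot (hp0 i)
  obtain ⟨t, ht0, ht⟩ : ∃ t ∈ Set.Ioi (0 : ℝ), t ∉ ⋃ i : s, {t : ℝ | (p i).IsRoot t} :=
    (Set.Ioi_infinite (0 : ℝ)).exists_notMem_finite hfin
  obtain ⟨i, hi, hx⟩ := h (∑ j : Fin n, t ^ (j : ℕ) • b j)
    (Submodule.sum_mem _ fun j _ => PointedCone.smul_mem C (pow_pos ht0 _).le (hb j))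
  refine ht (Set.mem_iUnion.2 ⟨⟨i, hi⟩, ?_⟩)
  have := hφ ⟨i, hi⟩ hx
  rw [LinearMap.mem_ker] at this
  simp only [Set.mem_ofPred_eq, Polynomial.IsRoot.def, p, Polynomial.eval_finsetSum,
    Polynomial.eval_monomial]
  rw [← this, map_sum]
  exact Finset.sum_congr rfl fun j _ => by rw [map_smul, smul_eq_mul, mul_comm]

lemma IsSubdivision.exists_isNondegenerate {N : Type*} [AddCommGroup N] [Module.Finite ℤ N]
    {F : Set (PointedCone ℝ (ℝ ⊗[ℤ] N))} {σ : PointedCone ℝ (ℝ ⊗[ℤ] N)}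
    (hF : IsSubdivision F σ) (hσ : IsNondegenerate σ) : ∃ τ ∈ F, IsNondegenerate τ := by
  obtain ⟨t, ht, hspan, hli⟩ := exists_linearIndependent ℝ (σ : Set (ℝ ⊗[ℤ] N))
  have hspan' : Submodule.span ℝ t = ⊤ := hspan.trans hσ
  let b : Module.Basis t ℝ (ℝ ⊗[ℤ] N) := Module.Basis.mk hli (by simp [hspan'])
  have : Fintype t := FiniteDimensional.fintypeBasisIndex b
  refine exists_eq_top_of_cone_subset (b.reindex (Fintype.equivFin t)) σ (fun i => ?_) F
    hF.1.finite (fun τ => Submodule.span ℝ (τ : Set (ℝ ⊗[ℤ] N))) fun x hx => ?_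
  · simpa [b] using ht (Subtype.coe_prop _)
  · have : x ∈ (σ : Set (ℝ ⊗[ℤ] N)) := hx
    rw [← hF.2] at this
    simp only [Set.mem_iUnion] at this
    obtain ⟨τ, hτ, hxτ⟩ := this
    exact ⟨τ, hτ, Submodule.subset_span hxτ⟩

end Subdivision

/-! ### Orders of functions along divisors -/

section DivisorOrder

variable {R : Type*} [CommRing R] [IsDomain R] (E : DivisorOver R)

namespace DivisorOver

lemma ordFrac_ne_zero {x : FractionRing R} (hx : x ≠ 0) : Ring.ordFrac E.localRing x ≠ 0 :=
  (map_ne_zero _).2 hx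

lemma ord_mul {x y : FractionRing R} (hx : x ≠ 0) (hy : y ≠ 0) :
    E.ord (x * y) = E.ord x + E.ord y := by
  rw [ord, map_mul, WithZero.log_mul (E.ordFrac_ne_zero hx) (E.ordFrac_ne_zero hy)]; rfl

@[simp] lemma ord_one : E.ord 1 = 0 := by simp [ord]

lemma ord_inv (x : FractionRing R) : E.ord x⁻¹ = - E.ord x := by
  rw [ord, map_inv₀, WithZero.log_inv]; rfl

lemma ord_div {x y : FractionRing R} (hx : x ≠ 0) (hy : y ≠ 0) :
    E.ord (x / y) = E.ord x - E.ord y := by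
  rw [div_eq_mul_inv, E.ord_mul hx (inv_ne_zero hy), ord_inv, sub_eq_add_neg]

lemma ord_pow (x : FractionRing R) (n : ℕ) : E.ord (x ^ n) = n * E.ord x := by
  rw [ord, map_pow, WithZero.log_pow, nsmul_eq_mul]; rfl

lemma ord_prod {ι : Type*} (s : Finset ι) (f : ι → FractionRing R) (hf : ∀ i ∈ s, f i ≠ 0) :
    E.ord (∏ i ∈ s, f i) = ∑ i ∈ s, E.ord (f i) := by
  classical
  induction s using Finset.induction_on with
  | empty => simp
  | insert a s ha ih =>
    rw [Finset.prod_insert ha, Finset.sum_insert ha, E.ord_mul (hf a (by simp))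
      (Finset.prod_ne_zero_iff.2 fun i hi => hf i (by simp [hi])), ih fun i hi => hf i (by simp [hi])]

lemma ord_coe_of_isUnit {x : E.localRing} (hx : IsUnit x) : E.ord (x : FractionRing R) = 0 := by
  have : Ring.ordFrac E.localRing (algebraMap E.localRing (FractionRing R) x) = 1 :=
    Ring.ordFrac_of_isUnit hx
  rw [ord]
  erw [this]
  simp

lemma ord_coe_nonneg {x : E.localRing} (hx : x ≠ 0) : 0 ≤ E.ord (x : FractionRing R) := by
  have h : 1 ≤ Ring.ordFrac E.localRing (algebraMap E.localRing (FractionRing R) x) :=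
    Ring.ordFrac_ge_one_of_ne_zero hx
  have := (WithZero.log_le_log one_ne_zero (zero_lt_one.trans_le h).ne').2 h
  rw [WithZero.log_one] at this
  exact this

lemma isUnit_coe_iff {x : E.localRing} (hx : x ≠ 0) :
    IsUnit x ↔ E.ord (x : FractionRing R) = 0 := by
  refine ⟨E.ord_coe_of_isUnit, fun h => ?_⟩
  rw [Ring.isUnit_iff_ordFrac_one_of_isDiscreteValuationRing (K := FractionRing R)]
  have hne := E.ordFrac_ne_zero (x := (x : FractionRing R)) (by simpa using hx)
  have h' : WithZero.log (Ring.ordFrac E.localRing (x : FractionRing R)) = 0 := h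
  change Ring.ordFrac E.localRing (x : FractionRing R) = 1
  rw [← WithZero.exp_log hne, h', WithZero.exp_zero]

lemma ord_coe_of_irreducible {x : E.localRing} (hx : Irreducible x) :
    E.ord (x : FractionRing R) = 1 := by
  have : Ring.ordFrac E.localRing (algebraMap E.localRing (FractionRing R) x) = WithZero.exp 1 :=
    Ring.ordFrac_irreducible hx
  rw [ord]
  erw [this]
  simp

lemma ord_algebraMap_nonneg {r : R} (hr : r ≠ 0) :
    0 ≤ E.ord (algebraMap R (FractionRing R) r) := by
  refine E.ord_coe_nonneg (x := algebraMap R E.localRing r) fun h => hr ?_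
  have := congrArg (algebraMap E.localRing (FractionRing R)) h
  rw [← IsScalarTower.algebraMap_apply, map_zero] at this
  exact (IsFractionRing.to_map_eq_zero_iff).1 this

lemma mem_center_iff {r : R} (hr : r ≠ 0) :
    r ∈ E.center.asIdeal ↔ 0 < E.ord (algebraMap R (FractionRing R) r) := by
  have hne : algebraMap R E.localRing r ≠ 0 := fun h => hr (by
    have := congrArg (algebraMap E.localRing (FractionRing R)) h
    rw [← IsScalarTower.algebraMap_apply, map_zero] at this
    exact (IsFractionRing.to_map_eq_zero_iff).1 this)
  have h1 : r ∈ E.center.asIdeal ↔ ¬ IsUnit (algebraMap R E.localRing r) := Iff.rfl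
  rw [h1, E.isUnit_coe_iff hne]
  have := E.ord_algebraMap_nonneg hr
  change ¬ (E.ord (algebraMap R (FractionRing R) r) = 0) ↔ _
  omega

/-- A divisor whose local ring is a localization of `R` has center of codimension one. -/
lemma height_center_eq_one (h : ∀ x ∈ E.localRing, ∃ a b : R, b ∉ E.center.asIdeal ∧
    x * algebraMap R (FractionRing R) b = algebraMap R (FractionRing R) a) :
    E.center.asIdeal.height = 1 := by
  have : IsLocalization.AtPrime E.localRing E.center.asIdeal := by
    constructor; constructor
    · rintro ⟨y, hy⟩
      by_contra hu
      exact hy hu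
    · rintro ⟨x, hx⟩
      obtain ⟨a, b, hb, hab⟩ := h x hx
      exact ⟨⟨a, b, hb⟩, Subtype.ext hab⟩
    · intro x y hxy
      refine ⟨1, ?_⟩
      have := congrArg (algebraMap E.localRing (FractionRing R)) hxy
      rw [← IsScalarTower.algebraMap_apply, ← IsScalarTower.algebraMap_apply] at this
      rw [IsFractionRing.injective R (FractionRing R) this]
  have h1 := IsLocalization.AtPrime.ringKrullDim_eq_height E.center.asIdeal E.localRing
  rw [IsDiscreteValuationRing.ringKrullDim_eq_one] at h1
  exact_mod_cast h1.symm

end DivisorOver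

end DivisorOrder

/-! ### Divisors obtained by localizing a subring at a prime element -/

section PrimeLocalization

variable {k R S K : Type*} [Field k] [CommRing R] [Field K] [Algebra R K] [CommRing S]
  [Algebra k S] [Algebra k K]

/-- The subring `O` of `K` is the localization of the ring `S ⊆ K` at its prime element `q`. -/
structure IsLocalizationAt (O : Subalgebra R K) (φ : S →ₐ[k] K) (q : S) : Prop where
  prime : Prime q
  injective : Function.Injective φ
  mem_iff : ∀ x, x ∈ O ↔ ∃ s t, ¬ q ∣ t ∧ x = φ s / φ t

/-- The localization of the ring `S ⊆ K` at its prime element `q`. -/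
def localizationAt (φ : S →ₐ[k] K) (hφ : Function.Injective φ) {q : S} (hq : Prime q)
    (hR : ∀ r : R, ∃ s t, ¬ q ∣ t ∧ algebraMap R K r = φ s / φ t) : Subalgebra R K where
  carrier := {x | ∃ s t, ¬ q ∣ t ∧ x = φ s / φ t}
  mul_mem' := by
    rintro _ _ ⟨s, t, ht, rfl⟩ ⟨s', t', ht', rfl⟩
    exact ⟨s * s', t * t', hq.not_dvd_mul ht ht', by rw [map_mul, map_mul, div_mul_div_comm]⟩
  add_mem' := by
    rintro _ _ ⟨s, t, ht, rfl⟩ ⟨s', t', ht', rfl⟩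
    have h0 : ∀ t, ¬ q ∣ t → φ t ≠ 0 := fun t ht =>
      (map_ne_zero_iff φ hφ).2 (by rintro rfl; exact ht (dvd_zero q))
    refine ⟨s * t' + t * s', t * t', hq.not_dvd_mul ht ht', ?_⟩
    rw [div_add_div _ _ (h0 t ht) (h0 t' ht')]
    simp
  algebraMap_mem' := hR

lemma isLocalizationAt_localizationAt (φ : S →ₐ[k] K) (hφ : Function.Injective φ) {q : S}
    (hq : Prime q) (hR : ∀ r : R, ∃ s t, ¬ q ∣ t ∧ algebraMap R K r = φ s / φ t) :
    IsLocalizationAt (localizationAt φ hφ hq hR) φ q :=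
  ⟨hq, hφ, fun _ => Iff.rfl⟩

namespace IsLocalizationAt

variable {O : Subalgebra R K} {φ : S →ₐ[k] K} {q : S} (h : IsLocalizationAt O φ q)
include h

lemma ne_zero_of_not_dvd {t : S} (ht : ¬ q ∣ t) : φ t ≠ 0 :=
  (map_ne_zero_iff φ h.injective).2 (by rintro rfl; exact ht (dvd_zero q))

lemma apply_mem (s : S) : φ s ∈ O :=
  (h.mem_iff _).2 ⟨s, 1, fun hd => h.prime.not_isUnit (isUnit_of_dvd_one hd), by simp⟩

/-- The inclusion of `S` into its localization. -/
def hom : S →+* O := (φ : S →+* K).codRestrict O h.apply_mem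

@[simp] lemma coe_hom (s : S) : (h.hom s : K) = φ s := rfl

lemma isUnit_hom {t : S} (ht : ¬ q ∣ t) : IsUnit (h.hom t) := by
  refine IsUnit.of_mul_eq_one ⟨(φ t)⁻¹, (h.mem_iff _).2 ⟨1, t, ht, by simp⟩⟩ (Subtype.ext ?_)
  exact mul_inv_cancel₀ (h.ne_zero_of_not_dvd ht)

lemma exists_mul_eq (x : O) : ∃ s t, ¬ q ∣ t ∧ x * h.hom t = h.hom s := by
  obtain ⟨s, t, ht, hx⟩ := (h.mem_iff _).1 x.2
  refine ⟨s, t, ht, Subtype.ext ?_⟩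
  change (x : K) * φ t = φ s
  rw [hx, div_mul_cancel₀ _ (h.ne_zero_of_not_dvd ht)]

lemma hom_injective : Function.Injective h.hom := fun _ _ hab =>
  h.injective (congrArg Subtype.val hab)

lemma not_isUnit_hom_prime : ¬ IsUnit (h.hom q) := by
  intro hu
  obtain ⟨y, hy⟩ := hu.exists_right_inv
  obtain ⟨s, t, ht, hst⟩ := h.exists_mul_eq y
  apply ht
  refine ⟨s, h.hom_injective ?_⟩
  rw [map_mul, ← hst, ← mul_assoc, hy, one_mul]

variable (q) in
lemma isLocalization [IsDomain S] :
    letI := h.hom.toAlgebra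
    haveI : (Ideal.span {q}).IsPrime := (Ideal.span_singleton_prime h.prime.ne_zero).2 h.prime
    IsLocalization (Ideal.span {q}).primeCompl O := by
  let := h.hom.toAlgebra
  have : (Ideal.span {q}).IsPrime := (Ideal.span_singleton_prime h.prime.ne_zero).2 h.prime
  constructor; constructor
  · rintro ⟨t, ht⟩
    exact h.isUnit_hom fun hd => ht (Ideal.mem_span_singleton.2 hd)
  · intro x
    obtain ⟨s, t, ht, hst⟩ := h.exists_mul_eq x
    exact ⟨⟨s, t, fun hd => ht (Ideal.mem_span_singleton.1 hd)⟩, hst⟩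
  · intro x y hxy
    exact ⟨1, by rw [h.hom_injective hxy]⟩

lemma exists_pow_mul_isUnit [IsDomain S] [WfDvdMonoid S] {x : O} (hx : x ≠ 0) :
    ∃ (n : ℕ) (u : O), IsUnit u ∧ x = h.hom q ^ n * u := by
  obtain ⟨s, t, ht, hst⟩ := h.exists_mul_eq x
  obtain ⟨y, hy⟩ := (h.isUnit_hom ht).exists_right_inv
  have hs : s ≠ 0 := by
    rintro rfl
    rw [map_zero, mul_eq_zero] at hst
    exact hst.elim hx (h.isUnit_hom ht).ne_zero
  obtain ⟨n, u, hu, rfl⟩ := WfDvdMonoid.max_power_factor hs h.prime.irreducible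
  refine ⟨n, h.hom u * y, (h.isUnit_hom hu).mul (IsUnit.of_mul_eq_one (h.hom t) ?_), ?_⟩
  · rw [mul_comm, hy]
  · rw [← mul_assoc, ← map_pow, ← map_mul, ← hst, mul_assoc, hy, mul_one]

lemma irreducible_hom [IsDomain S] [WfDvdMonoid S] : Irreducible (h.hom q) := by
  refine ⟨h.not_isUnit_hom_prime, fun a b hab => ?_⟩
  have hq0 : h.hom q ≠ 0 := (map_ne_zero_iff _ h.hom_injective).2 h.prime.ne_zero
  have ha : a ≠ 0 := by rintro rfl; simp [hq0] at hab
  have hb : b ≠ 0 := by rintro rfl; simp [hq0] at hab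
  obtain ⟨n, u, hu, rfl⟩ := h.exists_pow_mul_isUnit ha
  obtain ⟨m, v, hv, rfl⟩ := h.exists_pow_mul_isUnit hb
  by_cases hn : n = 0
  · left; simpa [hn] using hu
  by_cases hm : m = 0
  · right; simpa [hm] using hv
  exfalso
  obtain ⟨n, rfl⟩ := Nat.exists_eq_add_one_of_ne_zero hn
  obtain ⟨m, rfl⟩ := Nat.exists_eq_add_one_of_ne_zero hm
  apply h.not_isUnit_hom_prime
  refine IsUnit.of_mul_eq_one (h.hom q ^ (n + m) * u * v) (mul_left_cancel₀ hq0 ?_)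
  rw [mul_one]
  conv_rhs => rw [hab]
  ring

lemma isDiscreteValuationRing [IsDomain S] [WfDvdMonoid S] : IsDiscreteValuationRing O := by
  refine IsDiscreteValuationRing.ofHasUnitMulPowIrreducibleFactorization
    ⟨h.hom q, h.irreducible_hom, fun {x} hx => ?_⟩
  obtain ⟨n, u, hu, rfl⟩ := h.exists_pow_mul_isUnit hx
  exact ⟨n, hu.unit, rfl⟩

lemma essFiniteType [IsDomain S] [Algebra k R] [IsScalarTower k R K] [Algebra.EssFiniteType k S] :
    Algebra.EssFiniteType R O := by
  let := h.hom.toAlgebra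
  have : (Ideal.span {q}).IsPrime := (Ideal.span_singleton_prime h.prime.ne_zero).2 h.prime
  have := h.isLocalization
  have h1 : Algebra.EssFiniteType S O := .of_isLocalization _ (Ideal.span {q}).primeCompl
  have : IsScalarTower k S O := IsScalarTower.of_algebraMap_eq fun x => Subtype.ext (by
    change algebraMap k K x = φ (algebraMap k S x)
    rw [φ.commutes])
  have : Algebra.EssFiniteType k O := .comp k S O
  exact .of_comp k R O

end IsLocalizationAt

end PrimeLocalization

/-! ### Orders of differential forms -/

section FormOrder

lemma det_eq_det_mul {K V ι : Type*} [Field K] [AddCommGroup V] [Module K V] [Fintype ι]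
    [DecidableEq ι] (ω : Module.Basis ι K V) (v v' : ι → V) (P : Matrix ι ι K)
    (h : ∀ i, v' i = ∑ j, P i j • v j) : ω.det v' = P.det * ω.det v := by
  rw [ω.det_apply, ω.det_apply, ← Matrix.det_transpose P, mul_comm, ← Matrix.det_mul]
  congr 1
  ext i j
  simp [Module.Basis.toMatrix_apply, Matrix.mul_apply, h, mul_comm]

variable {k R : Type*} [Field k] [CommRing R] [IsDomain R] [Algebra k R]

/-- Two bases of the differentials of the local ring differ by a matrix whose determinant is a unit,
hence of order zero. -/
lemma HasFormOrd.unique {E : DivisorOver R} {ω : RationalForm R k} {n n' : ℤ}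
    (h : HasFormOrd E ω n) (h' : HasFormOrd E ω n') : n = n' := by
  obtain ⟨b, rfl⟩ := h
  obtain ⟨b', rfl⟩ := h'
  let F : Ω[E.localRing⁄k] →ₗ[E.localRing] Ω[FractionRing R⁄k] :=
    KaehlerDifferential.map k k E.localRing (FractionRing R)
  have hb : ∀ i, F (b' i) = ∑ j, (algebraMap E.localRing (FractionRing R)).mapMatrix
      (b.toMatrix b').transpose i j • F (b j) := by
    intro i
    conv_lhs => rw [← b.sum_repr (b' i), map_sum]
    refine Finset.sum_congr rfl fun j _ => ?_
    rw [map_smul]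
    exact (algebraMap_smul (FractionRing R) (b.repr (b' i) j) (F (b j))).symm
  have hdet := det_eq_det_mul ω (fun i => F (b i)) (fun i => F (b' i)) _ hb
  rw [← RingHom.map_det, Matrix.det_transpose, ← b.det_apply] at hdet
  have hu : IsUnit (b.det b') := b.isUnit_det b'
  change - E.ord (ω.det fun i => F (b i)) = - E.ord (ω.det fun i => F (b' i))
  rw [hdet]
  -- If the determinant were zero, both sides would be the same default value `E.ord 0`.
  by_cases h0 : (ω.det fun i => F (b i)) = 0
  · rw [h0, mul_zero]
  · rw [E.ord_mul _ h0]
    · have : E.ord (algebraMap E.localRing (FractionRing R) (b.det b')) = 0 :=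
        E.ord_coe_of_isUnit hu
      rw [this, zero_add]
    · exact (map_ne_zero_iff _ (IsFractionRing.injective _ _)).2 hu.ne_zero

variable {ι : Type*} (φ : MvPolynomial ι k →ₐ[k] FractionRing R)

/-- The function field is also the fraction field of the polynomial ring, and Kähler differentials
commute with localization, so the `dX i` remain a basis. -/
lemma exists_basis_kaehler_fractionRing (hφ : Function.Injective φ)
    (hfrac : ∀ x, ∃ s t, t ≠ 0 ∧ x = φ s / φ t) :
    ∃ b : Module.Basis ι (FractionRing R) (Ω[FractionRing R⁄k]),
      ∀ i, b i = KaehlerDifferential.D k (FractionRing R) (φ (MvPolynomial.X i)) := by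
  let := φ.toRingHom.toAlgebra
  have : IsScalarTower k (MvPolynomial ι k) (FractionRing R) :=
    IsScalarTower.of_algebraMap_eq fun x => (φ.commutes x).symm
  have : FaithfulSMul (MvPolynomial ι k) (FractionRing R) :=
    (faithfulSMul_iff_algebraMap_injective _ _).2 hφ
  have : IsFractionRing (MvPolynomial ι k) (FractionRing R) :=
    IsFractionRing.of_field _ _ fun x => by
      obtain ⟨s, t, -, h⟩ := hfrac x
      exact ⟨s, t, h⟩
  refine ⟨(KaehlerDifferential.mvPolynomialBasis k ι).ofIsLocalizedModule (FractionRing R)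
    (nonZeroDivisors (MvPolynomial ι k))
    (KaehlerDifferential.map k k (MvPolynomial ι k) (FractionRing R)), fun i => ?_⟩
  rw [Module.Basis.ofIsLocalizedModule_apply, KaehlerDifferential.mvPolynomialBasis_apply,
    KaehlerDifferential.map_D]
  rfl

lemma IsLocalizationAt.exists_basis_kaehler {O : Subalgebra R (FractionRing R)}
    {q : MvPolynomial ι k} {φ : MvPolynomial ι k →ₐ[k] FractionRing R}
    (h : IsLocalizationAt O φ q) :
    ∃ b : Module.Basis ι O (Ω[O⁄k]), ∀ i, KaehlerDifferential.map k k O (FractionRing R) (b i) =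
      KaehlerDifferential.D k (FractionRing R) (φ (MvPolynomial.X i)) := by
  let := h.hom.toAlgebra
  have : (Ideal.span {q}).IsPrime := (Ideal.span_singleton_prime h.prime.ne_zero).2 h.prime
  have := h.isLocalization
  have : IsScalarTower k (MvPolynomial ι k) O := IsScalarTower.of_algebraMap_eq fun x =>
    Subtype.ext (φ.commutes x).symm
  refine ⟨(KaehlerDifferential.mvPolynomialBasis k ι).ofIsLocalizedModule O
    (Ideal.span {q}).primeCompl (KaehlerDifferential.map k k (MvPolynomial ι k) O), fun i => ?_⟩
  rw [Module.Basis.ofIsLocalizedModule_apply, KaehlerDifferential.mvPolynomialBasis_apply,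
    KaehlerDifferential.map_D, KaehlerDifferential.map_D]
  rfl

/-- The order of a form along the divisor of a prime element of a polynomial ring `k[X] ⊆ K`. -/
lemma IsLocalizationAt.hasFormOrd {E : DivisorOver R}
    {q : MvPolynomial ι k} {φ : MvPolynomial ι k →ₐ[k] FractionRing R}
    (h : IsLocalizationAt E.localRing φ q) (ω : RationalForm R k)
    (e : Fin (Module.finrank (FractionRing R) (Ω[FractionRing R⁄k])) ≃ ι) :
    HasFormOrd E ω (- E.ord (ω.det fun i =>
      KaehlerDifferential.D k (FractionRing R) (φ (MvPolynomial.X (e i))))) := by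
  obtain ⟨b, hb⟩ := h.exists_basis_kaehler
  refine ⟨b.reindex e.symm, ?_⟩
  congr 3
  ext i
  simp [hb]

end FormOrder

/-! ### Laurent polynomials and clearing of denominators -/

section LaurentAlgebra

open AddMonoidAlgebra

variable {k : Type*} [Field k] {P M : Type*} [AddCommMonoid P] [AddCommGroup M]

/-- A monomial multiple of `a` comes from the submonoid `P` if this holds for each of the
monomials of `a`. -/
lemma exists_single_mul_eq_mapDomain (f : P →+ M) (u : P) (a : AddMonoidAlgebra k M)
    (h : ∀ m ∈ a.coeff.support, ∃ n : ℕ, m + n • f u ∈ Set.range f) :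
    ∃ (n : ℕ) (b : AddMonoidAlgebra k P), single (n • f u) 1 * a = mapDomainAlgHom k k f b := by
  classical
  have h' : ∀ m, ∃ n : ℕ, m ∈ a.coeff.support → m + n • f u ∈ Set.range f := fun m => by
    by_cases hm : m ∈ a.coeff.support
    · obtain ⟨n, hn⟩ := h m hm
      exact ⟨n, fun _ => hn⟩
    · exact ⟨0, fun h => absurd h hm⟩
  choose N hN using h'
  have key : ∀ m ∈ a.coeff.support, ∃ p, f p = a.coeff.support.sup N • f u + m := by
    intro m hm
    obtain ⟨p, hp⟩ := hN m hm
    refine ⟨p + (a.coeff.support.sup N - N m) • u, ?_⟩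
    have hle : N m ≤ a.coeff.support.sup N := Finset.le_sup hm
    rw [map_add, map_nsmul, hp, add_assoc, ← add_nsmul, Nat.add_sub_cancel' hle, add_comm]
  have key' : ∀ m, ∃ p, m ∈ a.coeff.support → f p = a.coeff.support.sup N • f u + m := fun m => by
    by_cases hm : m ∈ a.coeff.support
    · obtain ⟨p, hp⟩ := key m hm
      exact ⟨p, fun _ => hp⟩
    · exact ⟨0, fun h => absurd h hm⟩
  choose p hp using key'
  generalize a.coeff.support.sup N = n at *
  refine ⟨n, ∑ m ∈ a.coeff.support, single (p m) (a.coeff m), ?_⟩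
  conv_lhs => rw [← sum_coeff_single a, Finsupp.sum, Finset.mul_sum]
  rw [map_sum]
  refine Finset.sum_congr rfl fun m hm => ?_
  rw [single_mul_single, one_mul, ← hp m hm]
  simp

lemma coeff_mapDomainAlgHom {f : P →+ M} (hf : Function.Injective f) (b : AddMonoidAlgebra k P)
    (p : P) : (mapDomainAlgHom k k f b).coeff (f p) = b.coeff p :=
  Finsupp.mapDomain_apply hf _ _

lemma mem_range_of_mem_support_mapDomainAlgHom {f : P →+ M} {b : AddMonoidAlgebra k P} {m : M}
    (hm : m ∈ (mapDomainAlgHom k k f b).coeff.support) : ∃ p ∈ b.coeff.support, f p = m := by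
  classical
  have : m ∈ b.coeff.support.image f := Finsupp.mapDomain_support hm
  simpa using this

lemma mapDomainAlgHom_injective {f : P →+ M} (hf : Function.Injective f) :
    Function.Injective (mapDomainAlgHom k k f) :=
  mapDomain_injective hf

lemma isUnit_single (m : M) : IsUnit (single m (1 : k)) :=
  IsUnit.of_mul_eq_one (single (-m) 1) (by rw [single_mul_single]; simp [one_def])

end LaurentAlgebra

/-! ### The torus inside the toric variety -/

section Embedding

open AddMonoidAlgebra

variable (k : Type*) [Field k] {N : Type*} [AddCommGroup N] (σ : PointedCone ℝ (ℝ ⊗[ℤ] N))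

/-- The inclusion of the toric ring in the coordinate ring of the torus. -/
def toLaurent : toricRing k σ →ₐ[k] AddMonoidAlgebra k (Module.Dual ℤ N) :=
  mapDomainAlgHom k k (dualMonoid σ).subtype

lemma toLaurent_injective : Function.Injective (toLaurent k σ) :=
  mapDomainAlgHom_injective Subtype.val_injective

@[simp] lemma toLaurent_single (m : dualMonoid σ) (c : k) :
    toLaurent k σ (single m c) = single m.1 c := by simp [toLaurent]

/-- The coordinate ring of the torus, as a subring of the function field of the toric variety. -/
structure LaurentEmbedding where
  toHom : AddMonoidAlgebra k (Module.Dual ℤ N) →ₐ[k] FractionRing (toricRing k σ)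
  injective : Function.Injective toHom
  comp : ∀ r, toHom (toLaurent k σ r) = algebraMap _ _ r

variable {σ} in
-- The Laurent ring is the localization of the toric ring at the single character `χ^m₀`, so it maps
-- to the function field by the universal property.
lemma exists_laurentEmbedding {m₀ : Module.Dual ℤ N} (hm₀ : m₀ ∈ dualMonoid σ)
    (h : ∀ a : Module.Dual ℤ N, ∃ n : ℕ, a + n • m₀ ∈ dualMonoid σ) :
    Nonempty (LaurentEmbedding k σ) := by
  let x : toricRing k σ := single ⟨m₀, hm₀⟩ 1
  have hx : x ≠ 0 := by simp [x]
  let := (toLaurent k σ).toRingHom.toAlgebra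
  have hclear : ∀ a : AddMonoidAlgebra k (Module.Dual ℤ N), ∃ (n : ℕ) (b : toricRing k σ),
      single (n • m₀) 1 * a = toLaurent k σ b := fun a =>
    exists_single_mul_eq_mapDomain (dualMonoid σ).subtype ⟨m₀, hm₀⟩ a fun m _ => by
      obtain ⟨n, hn⟩ := h m
      exact ⟨n, ⟨_, hn⟩, rfl⟩
  have hpow : ∀ n : ℕ, toLaurent k σ (x ^ n) = single (n • m₀) 1 := fun n => by
    rw [map_pow]; simp [x, single_pow]
  have hloc : IsLocalization (Submonoid.powers x) (AddMonoidAlgebra k (Module.Dual ℤ N)) := by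
    constructor; constructor
    · rintro ⟨_, n, rfl⟩
      change IsUnit (toLaurent k σ (x ^ n))
      rw [hpow]
      exact isUnit_single _
    · intro a
      obtain ⟨n, b, hb⟩ := hclear a
      refine ⟨⟨b, ⟨x ^ n, n, rfl⟩⟩, ?_⟩
      change a * toLaurent k σ (x ^ n) = toLaurent k σ b
      rw [← hb, hpow, mul_comm]
    · intro a b hab
      exact ⟨1, by rw [toLaurent_injective k σ hab]⟩
  have hunit : ∀ y : Submonoid.powers x,
      IsUnit (algebraMap (toricRing k σ) (FractionRing (toricRing k σ)) y) := by
    rintro ⟨_, n, rfl⟩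
    exact ((map_ne_zero_iff _ (IsFractionRing.injective _ _)).2 (pow_ne_zero n hx)).isUnit
  let g : AddMonoidAlgebra k (Module.Dual ℤ N) →+* FractionRing (toricRing k σ) :=
    IsLocalization.lift hunit
  have hg : ∀ r, g (toLaurent k σ r) = algebraMap _ _ r := fun r => IsLocalization.lift_eq hunit r
  refine ⟨⟨⟨g, fun c => ?_⟩, ?_, hg⟩⟩
  · change g (algebraMap k _ c) = _
    rw [← (toLaurent k σ).commutes c, hg, ← IsScalarTower.algebraMap_apply]
  · rw [injective_iff_map_eq_zero]
    intro a ha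
    change g a = 0 at ha
    obtain ⟨n, b, hb⟩ := hclear a
    have h1 := hg b
    rw [← hb, map_mul, ha, mul_zero] at h1
    have hb0 : b = 0 := (IsFractionRing.to_map_eq_zero_iff).1 h1.symm
    rw [hb0, map_zero] at hb
    exact (isUnit_single (n • m₀)).mul_right_eq_zero.1 hb

end Embedding

/-! ### Polynomial charts given by bases of the dual lattice -/

section Chart

open AddMonoidAlgebra

variable {M : Type*} [AddCommGroup M] {ι : Type*}

/-- The lattice point with the given natural coordinates with respect to a basis. -/
def exponentHom (c : Module.Basis ι ℤ M) : (ι →₀ ℕ) →+ M :=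
  (c.repr.symm : (ι →₀ ℤ) →+ M).comp (Finsupp.mapRange.addMonoidHom (Nat.castAddMonoidHom ℤ))

lemma repr_exponentHom (c : Module.Basis ι ℤ M) (a : ι →₀ ℕ) (i : ι) :
    c.repr (exponentHom c a) i = a i := by
  simp [exponentHom]

lemma exponentHom_injective (c : Module.Basis ι ℤ M) : Function.Injective (exponentHom c) := by
  intro a b h
  ext i
  have := repr_exponentHom c a i
  rw [h, repr_exponentHom] at this
  exact_mod_cast this.symm

@[simp] lemma exponentHom_single (c : Module.Basis ι ℤ M) (i : ι) :
    exponentHom c (Finsupp.single i 1) = c i := by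
  simp [exponentHom]

lemma mem_range_exponentHom (c : Module.Basis ι ℤ M) {m : M} :
    m ∈ Set.range (exponentHom c) ↔ ∀ i, 0 ≤ c.repr m i := by
  constructor
  · rintro ⟨a, rfl⟩ i
    rw [repr_exponentHom]; exact Int.natCast_nonneg _
  · intro h
    refine ⟨Finsupp.mapRange Int.toNat rfl (c.repr m), c.repr.injective (Finsupp.ext fun i => ?_)⟩
    rw [repr_exponentHom, Finsupp.mapRange_apply, Int.toNat_of_nonneg (h i)]

lemma exists_add_nsmul_mem_range_exponentHom [Finite ι] (c : Module.Basis ι ℤ M) (u : ι →₀ ℕ)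
    (m : M) (h : ∀ i, u i = 0 → 0 ≤ c.repr m i) :
    ∃ n : ℕ, m + n • exponentHom c u ∈ Set.range (exponentHom c) := by
  have := Fintype.ofFinite ι
  refine ⟨∑ i, (c.repr m i).natAbs, (mem_range_exponentHom c).2 fun i => ?_⟩
  rw [map_add, map_nsmul, Finsupp.add_apply, Finsupp.smul_apply, repr_exponentHom, nsmul_eq_mul]
  by_cases hu : u i = 0
  · rw [hu]; simpa using h i hu
  · have h1 : (c.repr m i).natAbs ≤ ∑ i, (c.repr m i).natAbs :=
      Finset.single_le_sum (f := fun i => (c.repr m i).natAbs) (fun i _ => Nat.zero_le _)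
        (Finset.mem_univ i)
    have h2 : ((c.repr m i).natAbs : ℤ) ≤ ((∑ i, (c.repr m i).natAbs : ℕ) : ℤ) := by
      exact_mod_cast h1
    have h3 : ((∑ i, (c.repr m i).natAbs : ℕ) : ℤ) * 1 ≤
        ((∑ i, (c.repr m i).natAbs : ℕ) : ℤ) * (u i : ℤ) :=
      mul_le_mul_of_nonneg_left (by omega) (Int.natCast_nonneg _)
    omega

/-- A functional with `m v = 1` splits evaluation at `v`, so the dual lattice is `ℤ m` plus the
kernel of the evaluation. -/
lemma exists_basis_dual_of_isPrimitive {N : Type*} [AddCommGroup N] [Module.Free ℤ N]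
    [Module.Finite ℤ N] {n : ℕ} (hN : Module.finrank ℤ N = n + 1) {v : N} (hv : IsPrimitive v) :
    ∃ c : Module.Basis (Fin (n + 1)) ℤ (Module.Dual ℤ N), c 0 v = 1 ∧ ∀ i, i ≠ 0 → c i v = 0 := by
  obtain ⟨m, hm⟩ := hv.exists_dual
  let ev : Module.Dual ℤ N →ₗ[ℤ] ℤ := Module.Dual.eval ℤ N v
  obtain ⟨r, b⟩ := Submodule.basisOfPid (Module.Free.chooseBasis ℤ (Module.Dual ℤ N))
    (LinearMap.ker ev)
  let c := Module.Basis.mkFinCons m b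
    (fun z x hx h => by
      have h1 := congrArg ev h
      rw [map_add, LinearMap.mem_ker.1 hx, map_smul, add_zero, map_zero] at h1
      simpa [ev, hm] using h1)
    (fun z => ⟨- z v, by simp [ev, hm]⟩)
  have hr : r = n := by
    have h1 := Module.finrank_eq_card_basis c
    have h2 : Module.finrank ℤ (Module.Dual ℤ N) = n + 1 := by
      rw [← hN]; exact Module.finrank_linearMap_self ℤ ℤ N
    rw [h2, Fintype.card_fin] at h1
    omega
  subst hr
  refine ⟨c, by simp [c, hm], fun i hi => ?_⟩
  obtain ⟨j, rfl⟩ := Fin.exists_succ_eq.2 hi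
  have : ev (b j) = 0 := (b j).2
  rw [Module.Basis.coe_mkFinCons, Fin.cons_succ]
  exact this

end Chart

/-! ### Orders along the divisor of a prime element -/

section OrdLocalization

variable {k R S : Type*} [Field k] [CommRing R] [IsDomain R] [Algebra k R] [CommRing S]
  [Algebra k S] {E : DivisorOver R} {φ : S →ₐ[k] FractionRing R} {q : S}

lemma IsLocalizationAt.ord_of_not_dvd (h : IsLocalizationAt E.localRing φ q) {s : S}
    (hs : ¬ q ∣ s) : E.ord (φ s) = 0 :=
  (congrArg E.ord (h.coe_hom s)).symm.trans (E.ord_coe_of_isUnit (h.isUnit_hom hs))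

lemma IsLocalizationAt.ord_prime [IsDomain S] [WfDvdMonoid S] (h : IsLocalizationAt E.localRing φ q) :
    E.ord (φ q) = 1 :=
  (congrArg E.ord (h.coe_hom q)).symm.trans (E.ord_coe_of_irreducible h.irreducible_hom)

lemma IsLocalizationAt.ord_nonneg (h : IsLocalizationAt E.localRing φ q) {s : S} (hs : s ≠ 0) :
    0 ≤ E.ord (φ s) :=
  E.ord_coe_nonneg (x := h.hom s) ((map_ne_zero_iff _ h.hom_injective).2 hs)

lemma IsLocalizationAt.ord_pow_mul [IsDomain S] [WfDvdMonoid S] (h : IsLocalizationAt E.localRing φ q)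
    {n : ℕ} {s : S} (hs : ¬ q ∣ s) : E.ord (φ (q ^ n * s)) = n := by
  rw [map_mul, map_pow, E.ord_mul, E.ord_pow, h.ord_prime, h.ord_of_not_dvd hs]
  · simp
  · exact pow_ne_zero _ ((map_ne_zero_iff _ h.injective).2 h.prime.ne_zero)
  · exact h.ne_zero_of_not_dvd hs

lemma IsLocalizationAt.ord_pos_of_dvd [IsDomain S] [WfDvdMonoid S] (h : IsLocalizationAt E.localRing φ q)
    {s : S} (hs0 : s ≠ 0) (hs : q ∣ s) : 0 < E.ord (φ s) := by
  obtain ⟨t, rfl⟩ := hs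
  rw [map_mul, E.ord_mul ((map_ne_zero_iff _ h.injective).2 h.prime.ne_zero)
    ((map_ne_zero_iff _ h.injective).2 (right_ne_zero_of_mul hs0)), h.ord_prime]
  have := h.ord_nonneg (right_ne_zero_of_mul hs0)
  omega

end OrdLocalization

/-! ### Characters as rational functions, and divisors seen in a chart -/

namespace LaurentEmbedding

open AddMonoidAlgebra

variable {k : Type*} [Field k] {N : Type*} [AddCommGroup N] {σ : PointedCone ℝ (ℝ ⊗[ℤ] N)}
  (J : LaurentEmbedding k σ)

/-- The character of the torus with weight `m`, as a rational function. -/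
def chi (m : Module.Dual ℤ N) : FractionRing (toricRing k σ) := J.toHom (single m 1)

lemma chi_add (m m' : Module.Dual ℤ N) : J.chi (m + m') = J.chi m * J.chi m' := by
  rw [chi, chi, chi, ← map_mul, single_mul_single, one_mul]

@[simp] lemma chi_zero : J.chi 0 = 1 := by
  rw [chi, ← one_def, map_one]

lemma chi_ne_zero (m : Module.Dual ℤ N) : J.chi m ≠ 0 :=
  (map_ne_zero_iff _ J.injective).2 (isUnit_single m).ne_zero

lemma chi_nsmul (n : ℕ) (m : Module.Dual ℤ N) : J.chi (n • m) = J.chi m ^ n := by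
  induction n with
  | zero => simp
  | succ n ih => rw [succ_nsmul, chi_add, ih, pow_succ]

lemma algebraMap_single (m : dualMonoid σ) :
    algebraMap (toricRing k σ) _ (single m 1) = J.chi m := by
  rw [← J.comp, toLaurent_single]; rfl

/-- The order of characters along a divisor. -/
def ordChi (E : DivisorOver (toricRing k σ)) : Module.Dual ℤ N →+ ℤ where
  toFun m := E.ord (J.chi m)
  map_zero' := by simp
  map_add' m m' := by rw [chi_add, E.ord_mul (J.chi_ne_zero m) (J.chi_ne_zero m')]

variable {ι : Type*} (c : Module.Basis ι ℤ (Module.Dual ℤ N))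

/-- The polynomial ring in the characters of a lattice basis. -/
def chart : MvPolynomial ι k →ₐ[k] FractionRing (toricRing k σ) :=
  J.toHom.comp (mapDomainAlgHom k k (exponentHom c))

lemma chart_apply (s : MvPolynomial ι k) :
    J.chart c s = J.toHom (mapDomainAlgHom k k (exponentHom c) s) := rfl

lemma chart_injective : Function.Injective (J.chart c) :=
  J.injective.comp (mapDomainAlgHom_injective (exponentHom_injective c))

lemma chart_monomial (u : ι →₀ ℕ) :
    J.chart c (MvPolynomial.monomial u 1) = J.chi (exponentHom c u) := by
  rw [chart_apply]
  change J.toHom (mapDomainAlgHom k k (exponentHom c) (single u 1)) = _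
  simp [chi]

@[simp] lemma chart_X (i : ι) : J.chart c (MvPolynomial.X i) = J.chi (c i) := by
  rw [MvPolynomial.X, chart_monomial, exponentHom_single]

variable [Finite ι]

lemma exists_single_mul_eq (u : ι →₀ ℕ) (a : AddMonoidAlgebra k (Module.Dual ℤ N))
    (h : ∀ m ∈ a.coeff.support, ∀ i, u i = 0 → 0 ≤ c.repr m i) :
    ∃ (n : ℕ) (b : MvPolynomial ι k),
      single (n • exponentHom c u) 1 * a = mapDomainAlgHom k k (exponentHom c) b :=
  exists_single_mul_eq_mapDomain (exponentHom c) u a fun m hm =>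
    exists_add_nsmul_mem_range_exponentHom c u m (h m hm)

lemma exists_chart_monomial_mul_eq (u : ι →₀ ℕ) (a : AddMonoidAlgebra k (Module.Dual ℤ N))
    (h : ∀ m ∈ a.coeff.support, ∀ i, u i = 0 → 0 ≤ c.repr m i) :
    ∃ (n : ℕ) (b : MvPolynomial ι k),
      J.chart c (MvPolynomial.monomial u 1 ^ n) * J.toHom a = J.chart c b := by
  obtain ⟨n, b, hb⟩ := exists_single_mul_eq c u a h
  refine ⟨n, b, ?_⟩
  rw [chart_apply J c b, ← hb, map_mul, map_pow, chart_monomial, ← chi_nsmul]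
  rfl

lemma exists_eq_chart_div (x : FractionRing (toricRing k σ)) :
    ∃ s t, t ≠ 0 ∧ x = J.chart c s / J.chart c t := by
  have := Fintype.ofFinite ι
  obtain ⟨r, r', hr', rfl⟩ := IsFractionRing.div_surjective (A := toricRing k σ) x
  let u : ι →₀ ℕ := Finsupp.equivFunOnFinite.symm fun _ => 1
  have hu : ∀ i, u i ≠ 0 := fun i => by simp [u]
  have hm : ∀ n : ℕ, MvPolynomial.monomial u (1 : k) ^ n ≠ 0 := fun n =>
    pow_ne_zero n (by simp)
  have hφ := fun s => map_ne_zero_iff (J.chart c) (J.chart_injective c) (x := s)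
  obtain ⟨n, b, hb⟩ := J.exists_chart_monomial_mul_eq c u (toLaurent k σ r)
    fun m _ i hi => absurd hi (hu i)
  obtain ⟨n', b', hb'⟩ := J.exists_chart_monomial_mul_eq c u (toLaurent k σ r')
    fun m _ i hi => absurd hi (hu i)
  have hr0 : algebraMap (toricRing k σ) (FractionRing (toricRing k σ)) r' ≠ 0 :=
    (map_ne_zero_iff _ (IsFractionRing.injective _ _)).2 (nonZeroDivisors.ne_zero hr')
  rw [J.comp] at hb hb'
  refine ⟨MvPolynomial.monomial u 1 ^ n' * b, MvPolynomial.monomial u 1 ^ n * b', ?_, ?_⟩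
  · rw [← hφ, map_mul, ← hb']
    exact mul_ne_zero ((hφ _).2 (hm n)) (mul_ne_zero ((hφ _).2 (hm n')) hr0)
  · rw [map_mul, map_mul, ← hb, ← hb']
    have h1 := (hφ _).2 (hm n)
    have h2 := (hφ _).2 (hm n')
    field_simp

/-- The exponent `u` records which variables are inverted. The toric ring lies in the polynomial
ring with these variables inverted, hence in the localization at `q`, which does not divide their
product. -/
lemma exists_divisorOver {q : MvPolynomial ι k} (hq : Prime q) (u : ι →₀ ℕ)
    (hqu : ¬ q ∣ MvPolynomial.monomial u 1)
    (hu : ∀ m ∈ dualMonoid σ, ∀ i, u i = 0 → 0 ≤ c.repr m i) :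
    ∃ E : DivisorOver (toricRing k σ), IsLocalizationAt E.localRing (J.chart c) q := by
  have hR : ∀ r : toricRing k σ, ∃ s t, ¬ q ∣ t ∧
      algebraMap _ (FractionRing (toricRing k σ)) r = J.chart c s / J.chart c t := by
    intro r
    obtain ⟨n, b, hb⟩ := J.exists_chart_monomial_mul_eq c u (toLaurent k σ r) fun m hm => by
      obtain ⟨p, -, rfl⟩ := mem_range_of_mem_support_mapDomainAlgHom hm
      exact hu _ p.2
    refine ⟨b, MvPolynomial.monomial u 1 ^ n, fun hd => hqu (hq.dvd_of_dvd_pow hd), ?_⟩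
    rw [← hb, J.comp, mul_div_cancel_left₀]
    exact (map_ne_zero_iff _ (J.chart_injective c)).2 (pow_ne_zero n (by simp))
  have h := isLocalizationAt_localizationAt (J.chart c) (J.chart_injective c) hq hR
  exact ⟨⟨_, h.isDiscreteValuationRing, h.essFiniteType⟩, h⟩

end LaurentEmbedding

/-! ### Toric divisors and their centers -/

namespace LaurentEmbedding

open AddMonoidAlgebra

variable {k : Type*} [Field k] {N : Type*} [AddCommGroup N] {σ : PointedCone ℝ (ℝ ⊗[ℤ] N)}
  (J : LaurentEmbedding k σ)

/-- `E` is the toric divisor over `X_σ` corresponding to the ray spanned by `v`. -/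
def IsToricDivisor (E : DivisorOver (toricRing k σ)) (v : N) : Prop :=
  ∃ c : Module.Basis (Fin 3) ℤ (Module.Dual ℤ N), c 0 v = 1 ∧ (∀ i, i ≠ 0 → c i v = 0) ∧
    IsLocalizationAt E.localRing (J.chart c) (MvPolynomial.X 0)

lemma repr_zero_eq {c : Module.Basis (Fin 3) ℤ (Module.Dual ℤ N)} {v : N} (h0 : c 0 v = 1)
    (h : ∀ i, i ≠ 0 → c i v = 0) (m : Module.Dual ℤ N) : c.repr m 0 = m v := by
  have := LinearMap.congr_fun (c.sum_repr m) v
  rw [← this, Fin.sum_univ_three]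
  simp [h0, h 1, h 2]

variable [Module.Free ℤ N] [Module.Finite ℤ N] in
lemma exists_isToricDivisor (hN : Module.finrank ℤ N = 3) {v : N} (hv : IsPrimitive v)
    (hvσ : latticePoint v ∈ σ) : ∃ E, J.IsToricDivisor E v := by
  obtain ⟨c, h0, h⟩ := exists_basis_dual_of_isPrimitive hN hv
  -- All variables but `X 0` are inverted; the exponent of `X 0` in `χ^m` is `m v`, which is
  -- nonnegative for `m ∈ σ^∨`.
  let u : Fin 3 →₀ ℕ := Finsupp.equivFunOnFinite.symm fun i => if i = 0 then 0 else 1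
  obtain ⟨E, hE⟩ := J.exists_divisorOver c (q := MvPolynomial.X 0) MvPolynomial.X_prime u
    (by rw [MvPolynomial.X_dvd_monomial]; simp [u]) fun m hm i hi => by
      have hi0 : i = 0 := by
        by_contra hne
        simp [u, hne] at hi
      rw [hi0, repr_zero_eq h0 h]
      exact nonneg_of_mem_dualMonoid hm hvσ
  exact ⟨E, c, h0, h, hE⟩

variable {J} {E : DivisorOver (toricRing k σ)} {v : N}

lemma IsToricDivisor.ord_chi (hE : J.IsToricDivisor E v) (m : Module.Dual ℤ N) :
    E.ord (J.chi m) = m v := by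
  obtain ⟨c, h0, h, hE⟩ := hE
  have : (J.ordChi E).toIntLinearMap = Module.Dual.eval ℤ N v := by
    refine c.ext fun i => ?_
    change E.ord (J.chi (c i)) = c i v
    rw [← J.chart_X]
    by_cases hi : i = 0
    · rw [hi, h0, hE.ord_prime]
    · rw [h i hi, hE.ord_of_not_dvd]
      rw [MvPolynomial.X_dvd_X]
      exact fun h => hi h.symm
  exact LinearMap.congr_fun this m

lemma le_of_X_pow_mul_coeff_ne_zero {ι : Type*} {i : ι} {n : ℕ} {w : MvPolynomial ι k}
    {p : ι →₀ ℕ} (h : MvPolynomial.coeff p (MvPolynomial.X i ^ n * w) ≠ 0) : n ≤ p i := by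
  classical
  rw [MvPolynomial.X_pow_eq_monomial, MvPolynomial.coeff_monomial_mul'] at h
  by_contra hlt
  apply h
  rw [if_neg]
  intro hle
  have := hle i
  simp only [Finsupp.single_eq_same] at this
  exact hlt this

/-- The order of a Laurent polynomial along a toric divisor is at most the order of each of its
monomials. -/
lemma IsToricDivisor.ord_le (hE : J.IsToricDivisor E v)
    {a : AddMonoidAlgebra k (Module.Dual ℤ N)} {m : Module.Dual ℤ N} (hm : a.coeff m ≠ 0) :
    E.ord (J.toHom a) ≤ m v := by
  have hchi := hE.ord_chi
  obtain ⟨c, h0, h, hE⟩ := hE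
  let u : Fin 3 →₀ ℕ := Finsupp.equivFunOnFinite.symm fun _ => 1
  obtain ⟨n, b, hb⟩ := exists_single_mul_eq c u a fun m _ i hi => by simp [u] at hi
  have hcoeff : (mapDomainAlgHom k k (exponentHom c) b).coeff (n • exponentHom c u + m) ≠ 0 := by
    rw [← hb, coeff_single_mul_add, one_mul]
    exact hm
  obtain ⟨p, hp, hpm⟩ := mem_range_of_mem_support_mapDomainAlgHom (Finsupp.mem_support_iff.2 hcoeff)
  have hp0 : (p 0 : ℤ) = n + m v := by
    have h1 := repr_exponentHom c p 0
    rw [hpm, map_add, map_nsmul, Finsupp.add_apply, Finsupp.smul_apply, repr_exponentHom,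
      repr_zero_eq h0 h] at h1
    rw [← h1]
    simp [u]
  have hb0 : b ≠ 0 := by
    rintro rfl
    simp at hp
  have ha0 : a ≠ 0 := by
    rintro rfl
    simp at hm
  -- The order along `E` is the exact power `j` of `X 0` in `b`, and `X 0` occurs in every monomial
  -- of `b` with exponent at least `j`.
  obtain ⟨j, w, hw, rfl⟩ := WfDvdMonoid.max_power_factor hb0
    (MvPolynomial.X_prime (i := (0 : Fin 3))).irreducible
  have hj : j ≤ p 0 := le_of_X_pow_mul_coeff_ne_zero (Finsupp.mem_support_iff.1 hp)
  have h1 := congrArg (fun x => E.ord (J.toHom x)) hb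
  simp only [map_mul] at h1
  have h2 : E.ord (J.chart c (MvPolynomial.X 0 ^ j * w)) = j := hE.ord_pow_mul hw
  rw [chart_apply, map_mul, map_mul] at h2
  rw [h2] at h1
  change E.ord (J.chi _ * J.toHom a) = j at h1
  rw [E.ord_mul (J.chi_ne_zero _) ((map_ne_zero_iff _ J.injective).2 ha0)] at h1
  have h3 : E.ord (J.chi (n • exponentHom c u)) = n := by
    rw [hchi, ← repr_zero_eq h0 h, map_nsmul, Finsupp.smul_apply, repr_exponentHom]
    simp [u]
  rw [h3] at h1
  omega

/-- Characters have order zero along the divisor of a prime polynomial that is not a variable. -/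
lemma ord_chi_eq_zero {ι : Type*} {c : Module.Basis ι ℤ (Module.Dual ℤ N)}
    {q : MvPolynomial ι k} (hE : IsLocalizationAt E.localRing (J.chart c) q)
    (hq : ∀ i, ¬ q ∣ MvPolynomial.X i) (m : Module.Dual ℤ N) : E.ord (J.chi m) = 0 := by
  have : (J.ordChi E).toIntLinearMap = 0 := by
    refine c.ext fun i => ?_
    change E.ord (J.chi (c i)) = 0
    rw [← J.chart_X, hE.ord_of_not_dvd (hq i)]
  exact LinearMap.congr_fun this m

lemma not_dvd_monomial {ι : Type*} {q : MvPolynomial ι k} (hq : Prime q)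
    (h : ∀ i, ¬ q ∣ MvPolynomial.X i) (u : ι →₀ ℕ) : ¬ q ∣ MvPolynomial.monomial u 1 := by
  rw [← MvPolynomial.prod_X_pow_eq_monomial, hq.dvd_finsetProd_iff]
  rintro ⟨i, -, hi⟩
  exact h i (hq.dvd_of_dvd_pow hi)

variable (J) in
lemma exists_divisorOver_of_prime {ι : Type*} [Finite ι]
    (c : Module.Basis ι ℤ (Module.Dual ℤ N)) {q : MvPolynomial ι k} (hq : Prime q)
    (h : ∀ i, ¬ q ∣ MvPolynomial.X i) :
    ∃ E : DivisorOver (toricRing k σ), IsLocalizationAt E.localRing (J.chart c) q :=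
  J.exists_divisorOver c hq (Finsupp.equivFunOnFinite.symm fun _ => 1) (not_dvd_monomial hq h _)
    fun m _ i hi => by simp at hi

/-- The center is of codimension one if the divisor is visible on a toric chart of `X_σ`. -/
lemma height_center_eq_one {ι : Type*} {c : Module.Basis ι ℤ (Module.Dual ℤ N)}
    {q : MvPolynomial ι k} (hE : IsLocalizationAt E.localRing (J.chart c) q)
    {m' : Module.Dual ℤ N} (hm' : m' ∈ dualMonoid σ) (hord : E.ord (J.chi m') = 0)
    (h : ∀ u : ι →₀ ℕ, ∃ n : ℕ, exponentHom c u + n • m' ∈ dualMonoid σ) :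
    E.center.asIdeal.height = 1 := by
  refine E.height_center_eq_one fun x hx => ?_
  obtain ⟨s, t, ht, rfl⟩ := (hE.mem_iff x).1 hx
  have key : ∀ s : MvPolynomial ι k, ∃ (n : ℕ) (r : toricRing k σ),
      J.chi m' ^ n * J.chart c s = algebraMap _ _ r := by
    intro s
    obtain ⟨n, r, hr⟩ := exists_single_mul_eq_mapDomain (dualMonoid σ).subtype ⟨m', hm'⟩
      (mapDomainAlgHom k k (exponentHom c) s) fun m hm => by
        obtain ⟨p, -, rfl⟩ := mem_range_of_mem_support_mapDomainAlgHom hm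
        obtain ⟨n, hn⟩ := h p
        exact ⟨n, ⟨_, hn⟩, rfl⟩
    refine ⟨n, r, ?_⟩
    rw [← J.comp, toLaurent, ← hr, map_mul, ← chi_nsmul]
    rfl
  obtain ⟨n, r, hr⟩ := key s
  obtain ⟨n', r', hr'⟩ := key t
  have ht0 : J.chart c t ≠ 0 := hE.ne_zero_of_not_dvd ht
  have hchi : algebraMap (toricRing k σ) (FractionRing (toricRing k σ))
      (single ⟨m', hm'⟩ 1) = J.chi m' := J.algebraMap_single ⟨m', hm'⟩
  have hpow : ∀ n : ℕ, J.chi m' ^ n ≠ 0 := fun n => pow_ne_zero n (J.chi_ne_zero m')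
  refine ⟨single ⟨m', hm'⟩ 1 ^ n' * r, single ⟨m', hm'⟩ 1 ^ n * r', ?_, ?_⟩
  · have hne : algebraMap (toricRing k σ) (FractionRing (toricRing k σ))
        (single ⟨m', hm'⟩ 1 ^ n * r') = J.chi m' ^ n * (J.chi m' ^ n' * J.chart c t) := by
      rw [map_mul, map_pow, hchi, hr']
    have h0 : single ⟨m', hm'⟩ 1 ^ n * r' ≠ 0 := by
      intro h0
      rw [h0, map_zero] at hne
      exact mul_ne_zero (hpow n) (mul_ne_zero (hpow n') ht0) hne.symm
    rw [E.mem_center_iff h0, hne, E.ord_mul (hpow n) (mul_ne_zero (hpow n') ht0),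
      E.ord_mul (hpow n') ht0, E.ord_pow, E.ord_pow, hord, hE.ord_of_not_dvd ht]
    simp
  · rw [map_mul, map_mul, map_pow, map_pow, hchi, ← hr, ← hr']
    field_simp

/-- The toric divisor of `v` is exceptional if `v` lies off the ray of some generator `e` of the
smallest face containing `v`. -/
lemma IsToricDivisor.isExceptional (hE : J.IsToricDivisor E v) {e : N}
    {E' : DivisorOver (toricRing k σ)} (hE' : J.IsToricDivisor E' e)
    (hvσ : latticePoint v ∈ σ) {m₀ : Module.Dual ℤ N} (hm₀ : m₀ ∈ dualMonoid σ) (he : 0 < m₀ e)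
    (hle : ∀ m ∈ dualMonoid σ, m v = 0 → m e = 0)
    {m₁ : Module.Dual ℤ N} (hm₁ : m₁ ∈ dualMonoid σ) (h1e : m₁ e = 0) (h1v : 0 < m₁ v) :
    E.IsExceptional := by
  have hs : ∀ (m : dualMonoid σ) (E : DivisorOver (toricRing k σ)) (v : N),
      J.IsToricDivisor E v → (single m (1 : k) ∈ E.center.asIdeal ↔ 0 < m.1 v) := by
    intro m E v hE
    rw [E.mem_center_iff (by simp), J.algebraMap_single, hE.ord_chi]
  -- The height is bounded below by the chain `0 < center E' < center E`. Here `χ^m₀` makes the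
  -- first inclusion strict and `χ^m₁` the second.
  have h1 : (⊥ : Ideal (toricRing k σ)) < E'.center.asIdeal := by
    refine bot_lt_iff_ne_bot.2 fun h => ?_
    have := (hs ⟨m₀, hm₀⟩ E' e hE').2 he
    rw [h, Ideal.mem_bot] at this
    simp at this
  have h2 : E'.center.asIdeal < E.center.asIdeal := by
    refine lt_of_le_of_ne (fun r hr => ?_) fun h => ?_
    · by_cases hr0 : r = 0
      · rw [hr0]; exact zero_mem _
      rw [E'.mem_center_iff hr0, ← J.comp] at hr
      -- By `ord_le`, each monomial of `r` has positive order along `E'`. By `hle` it then also has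
      -- positive order along `E`.
      rw [← sum_coeff_single r]
      refine sum_mem fun m hm => ?_
      have hmr : (toLaurent k σ r).coeff m.1 ≠ 0 := by
        have := coeff_mapDomainAlgHom (k := k) (f := (dualMonoid σ).subtype)
          Subtype.val_injective r m
        exact fun h0 => Finsupp.mem_support_iff.1 hm (this.symm.trans h0)
      have hme := hr.trans_le (hE'.ord_le hmr)
      have hmv : 0 < m.1 v := lt_of_le_of_ne (nonneg_of_mem_dualMonoid m.2 hvσ) fun h0 => by
        have := hle _ m.2 h0.symm
        omega
      have h3 : single m (r.coeff m) = single 0 (r.coeff m) * single m 1 := by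
        rw [single_mul_single, zero_add, mul_one]
      rw [h3]
      exact Ideal.mul_mem_left _ _ ((hs m E v hE).2 hmv)
    · have := (hs ⟨m₁, hm₁⟩ E v hE).2 h1v
      rw [← h, hs ⟨m₁, hm₁⟩ E' e hE'] at this
      exact absurd this (by simp [h1e])
  have h3 := Ideal.height_add_one_le_of_lt_of_isPrime h1
  have h4 := Ideal.height_add_one_le_of_lt_of_isPrime h2
  rw [DivisorOver.IsExceptional]
  calc (2 : ℕ∞) = 0 + 1 + 1 := by norm_num
    _ ≤ (⊥ : Ideal (toricRing k σ)).height + 1 + 1 := by gcongr; exact zero_le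
    _ ≤ E'.center.asIdeal.height + 1 := by gcongr
    _ ≤ _ := h4

end LaurentEmbedding

/-! ### The torus-fixed point -/

section Origin

open AddMonoidAlgebra

variable (k : Type*) [Field k] {N : Type*} [AddCommGroup N] {σ : PointedCone ℝ (ℝ ⊗[ℤ] N)}

open Classical in
/-- Evaluation of the regular functions at the torus-fixed point. -/
def originHom (hσ : ∀ m ∈ dualMonoid σ, -m ∈ dualMonoid σ → m = 0) : toricRing k σ →ₐ[k] k :=
  lift k k (dualMonoid σ)
    { toFun := fun m => if m.toAdd = 0 then 1 else 0
      map_one' := by simp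
      map_mul' := fun m m' => by
        have h : m.toAdd + m'.toAdd = 0 ↔ m.toAdd = 0 ∧ m'.toAdd = 0 := by
          refine ⟨fun h => ?_, fun ⟨h, h'⟩ => by rw [h, h', add_zero]⟩
          have hval : (m.toAdd : Module.Dual ℤ N) + m'.toAdd = 0 := congrArg Subtype.val h
          have h1 : (m.toAdd : Module.Dual ℤ N) = 0 := hσ _ m.toAdd.2 (by
            rw [neg_eq_of_add_eq_zero_right hval]; exact m'.toAdd.2)
          rw [h1, zero_add] at hval
          exact ⟨Subtype.ext h1, Subtype.ext hval⟩
        simp only [toAdd_mul, h]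
        split_ifs <;> simp_all }

lemma originHom_apply (hσ : ∀ m ∈ dualMonoid σ, -m ∈ dualMonoid σ → m = 0) (r : toricRing k σ) :
    originHom k hσ r = r.coeff 0 := by
  classical
  conv_lhs => rw [← sum_coeff_single r, Finsupp.sum, map_sum]
  simp only [originHom, lift_single, MonoidHom.coe_mk, OneHom.coe_mk, toAdd_ofAdd, smul_eq_mul,
    mul_ite, mul_one, mul_zero, Finset.sum_ite_eq']
  split_ifs with h
  · rfl
  · exact (Finsupp.notMem_support_iff.1 h).symm

/-- The torus-fixed point of `X_σ`, for `σ` of full dimension. -/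
def origin (hσ : ∀ m ∈ dualMonoid σ, -m ∈ dualMonoid σ → m = 0) :
    PrimeSpectrum (toricRing k σ) :=
  ⟨RingHom.ker (originHom k hσ), RingHom.ker_isPrime _⟩

lemma mem_origin_iff (hσ : ∀ m ∈ dualMonoid σ, -m ∈ dualMonoid σ → m = 0) {r : toricRing k σ} :
    r ∈ (origin k hσ).asIdeal ↔ r.coeff 0 = 0 := by
  rw [← originHom_apply k hσ]; rfl

end Origin

/-! ### Functions with linear order along the toric divisors -/

namespace LaurentEmbedding

open AddMonoidAlgebra

variable {k : Type*} [Field k] {N : Type*} [AddCommGroup N] {σ : PointedCone ℝ (ℝ ⊗[ℤ] N)}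
  {J : LaurentEmbedding k σ} (hσ : ∀ m ∈ dualMonoid σ, -m ∈ dualMonoid σ → m = 0)

lemma IsToricDivisor.ord_algebraMap_le {E : DivisorOver (toricRing k σ)} {v : N}
    (hE : J.IsToricDivisor E v) {r : toricRing k σ} (hr : r.coeff 0 ≠ 0) :
    E.ord (algebraMap _ _ r) ≤ 0 := by
  have h1 : (toLaurent k σ r).coeff 0 ≠ 0 := by
    have := coeff_mapDomainAlgHom (k := k) (f := (dualMonoid σ).subtype)
      Subtype.val_injective r 0
    exact fun h0 => hr (this.symm.trans h0)
  rw [← J.comp]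
  exact (hE.ord_le h1).trans (by simp)

/-- A nonzero constant term is a monomial of order zero and bounds the order by zero, so the
function cannot vanish along `E`. -/
lemma IsToricDivisor.center_le_origin {E : DivisorOver (toricRing k σ)} {v : N}
    (hE : J.IsToricDivisor E v) : E.center.asIdeal ≤ (origin k hσ).asIdeal := by
  intro r hr
  by_cases hr0 : r = 0
  · rw [hr0]; exact zero_mem _
  rw [mem_origin_iff]
  by_contra h
  rw [E.mem_center_iff hr0] at hr
  exact absurd (hE.ord_algebraMap_le h) (by omega)

variable (J) in
/-- The order of `f` along the toric divisor of `v` is a linear function of `v`. -/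
def HasLinearOrd (f : FractionRing (toricRing k σ)) : Prop :=
  ∃ l : Module.Dual ℤ N, ∀ (E : DivisorOver (toricRing k σ)) (v : N),
    J.IsToricDivisor E v → E.ord f = l v

lemma HasLinearOrd.mul {f g : FractionRing (toricRing k σ)} (hf0 : f ≠ 0) (hg0 : g ≠ 0)
    (hf : J.HasLinearOrd f) (hg : J.HasLinearOrd g) : J.HasLinearOrd (f * g) := by
  obtain ⟨l, hl⟩ := hf
  obtain ⟨l', hl'⟩ := hg
  exact ⟨l + l', fun E v hE => by
    rw [E.ord_mul hf0 hg0, hl E v hE, hl' E v hE, LinearMap.add_apply]⟩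

lemma HasLinearOrd.inv {f : FractionRing (toricRing k σ)} (hf : J.HasLinearOrd f) :
    J.HasLinearOrd f⁻¹ := by
  obtain ⟨l, hl⟩ := hf
  exact ⟨-l, fun E v hE => by rw [E.ord_inv, hl E v hE, LinearMap.neg_apply]⟩

lemma hasLinearOrd_chi (m : Module.Dual ℤ N) : J.HasLinearOrd (J.chi m) :=
  ⟨m, fun _ _ hE => hE.ord_chi m⟩

/-- A unit and its inverse both have nonzero constant term, so both orders are at most zero, and
they add up to zero. -/
lemma hasLinearOrd_of_isUnit {ι : Type*} (c : Module.Basis ι ℤ (Module.Dual ℤ N))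
    {u : MvPolynomial ι k} (hu : IsUnit u) : J.HasLinearOrd (J.chart c u) := by
  have key : ∀ u : MvPolynomial ι k, IsUnit u → ∀ (E : DivisorOver (toricRing k σ)) (v : N),
      J.IsToricDivisor E v → E.ord (J.chart c u) ≤ 0 := fun u hu E v hE => by
    have h0 : (mapDomainAlgHom k k (exponentHom c) u).coeff (exponentHom c 0) ≠ 0 := by
      rw [coeff_mapDomainAlgHom (exponentHom_injective c)]
      exact (MvPolynomial.isUnit_iff.1 hu).1.ne_zero
    exact (hE.ord_le h0).trans (by simp)
  refine ⟨0, fun E v hE => ?_⟩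
  obtain ⟨w, hw⟩ := hu.exists_right_inv
  have h1 := key u hu E v hE
  have h2 := key w (IsUnit.of_mul_eq_one u (by rw [mul_comm, hw])) E v hE
  have hφ := fun s => map_ne_zero_iff (J.chart c) (J.chart_injective c) (x := s)
  have h3 := congrArg (fun s => E.ord (J.chart c s)) hw
  simp only [map_mul, map_one, DivisorOver.ord_one] at h3
  rw [E.ord_mul ((hφ _).2 hu.ne_zero) ((hφ _).2 (right_ne_zero_of_mul_eq_one hw))] at h3
  rw [LinearMap.zero_apply]
  omega

/-- A prime polynomial whose divisor avoids the torus-fixed point has linear order along the toric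
divisors. -/
lemma hasLinearOrd_of_center_not_le {ι : Type*} [Finite ι]
    (c : Module.Basis ι ℤ (Module.Dual ℤ N)) {q : MvPolynomial ι k}
    (hq : ∀ i, ¬ q ∣ MvPolynomial.X i) {E : DivisorOver (toricRing k σ)}
    (hE : IsLocalizationAt E.localRing (J.chart c) q)
    (hc : ¬ E.center.asIdeal ≤ (origin k hσ).asIdeal) : J.HasLinearOrd (J.chart c q) := by
  classical
  -- A regular function vanishing on the divisor of `q` but not at the fixed point. After
  -- multiplication by a character it becomes a multiple `q * w`, in which the constant term of `r`
  -- sits at the monomial `n • u`.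
  obtain ⟨r, hr, hr'⟩ := SetLike.not_le_iff_exists.1 hc
  rw [mem_origin_iff] at hr'
  have hr0 : r ≠ 0 := by
    rintro rfl
    simp at hr'
  rw [E.mem_center_iff hr0] at hr
  have hrK : algebraMap (toricRing k σ) (FractionRing (toricRing k σ)) r ≠ 0 :=
    (map_ne_zero_iff _ (IsFractionRing.injective _ _)).2 hr0
  let u : ι →₀ ℕ := Finsupp.equivFunOnFinite.symm fun _ => 1
  obtain ⟨n, b, hb⟩ := exists_single_mul_eq c u (toLaurent k σ r) fun m _ i hi => by simp [u] at hi
  have hbJ : J.chi (n • exponentHom c u) * algebraMap _ _ r = J.chart c b := by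
    rw [chart_apply, ← hb, map_mul, J.comp]; rfl
  have hqb : q ∣ b := by
    by_contra h
    have h1 := hE.ord_of_not_dvd h
    rw [← hbJ, E.ord_mul (J.chi_ne_zero _) hrK, ord_chi_eq_zero hE hq] at h1
    omega
  obtain ⟨w, rfl⟩ := hqb
  have hcoeff : MvPolynomial.coeff (n • u) (q * w) ≠ 0 := by
    have h1 := coeff_mapDomainAlgHom (k := k) (exponentHom_injective c) (q * w) (n • u)
    have h3 : (single (n • exponentHom c u) (1 : k) * toLaurent k σ r).coeff (n • exponentHom c u) =
        (toLaurent k σ r).coeff 0 := by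
      simp
    rw [← hb, map_nsmul, h3] at h1
    have h2 := coeff_mapDomainAlgHom (k := k) (f := (dualMonoid σ).subtype)
      Subtype.val_injective r 0
    exact fun h0 => hr' (h2.symm.trans (h1.trans h0))
  rw [MvPolynomial.coeff_mul] at hcoeff
  -- That monomial is a product of monomials `a` of `q` and `a'` of `w`. Their values at `v` bound
  -- the orders of `q` and `w` from above, while the two orders add up to at least `(a + a')(v)`
  -- because `r` is regular. Both bounds are therefore equalities.
  obtain ⟨⟨a, a'⟩, haa, hne⟩ := Finset.exists_ne_zero_of_sum_ne_zero hcoeff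
  replace haa : a + a' = n • u := Finset.HasAntidiagonal.mem_antidiagonal.1 haa
  refine ⟨exponentHom c a, fun E v hE => ?_⟩
  have key : ∀ (s : MvPolynomial ι k) (p : ι →₀ ℕ), MvPolynomial.coeff p s ≠ 0 →
      E.ord (J.chart c s) ≤ exponentHom c p v := fun s p hp => by
    rw [chart_apply]
    refine hE.ord_le ?_
    rw [coeff_mapDomainAlgHom (exponentHom_injective c)]
    exact hp
  have h1 := key q a (left_ne_zero_of_mul hne)
  have h2 := key w a' (right_ne_zero_of_mul hne)
  have h3 := congrArg E.ord hbJ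
  have h4 := E.ord_algebraMap_nonneg hr0
  have hw0 : q * w ≠ 0 := by
    intro h0
    rw [h0, map_zero] at hbJ
    exact mul_ne_zero (J.chi_ne_zero _) hrK hbJ
  have hφ := fun s => map_ne_zero_iff (J.chart c) (J.chart_injective c) (x := s)
  rw [E.ord_mul (J.chi_ne_zero _) hrK, hE.ord_chi, map_mul, E.ord_mul
    ((hφ _).2 (left_ne_zero_of_mul hw0)) ((hφ _).2 (right_ne_zero_of_mul hw0)), ← map_nsmul,
    ← haa, map_add, LinearMap.add_apply] at h3
  omega

/-- A rational function without zeros and poles through the torus-fixed point, apart from the toric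
prime divisors, has linear order along the toric divisors. -/
theorem hasLinearOrd_of_ord_eq_zero {ι : Type*} [Finite ι]
    (c : Module.Basis ι ℤ (Module.Dual ℤ N)) {f : FractionRing (toricRing k σ)} (hf : f ≠ 0)
    (h : ∀ (E : DivisorOver (toricRing k σ)) (q : MvPolynomial ι k),
      (∀ i, ¬ q ∣ MvPolynomial.X i) → IsLocalizationAt E.localRing (J.chart c) q →
      E.center.asIdeal ≤ (origin k hσ).asIdeal → E.ord f = 0) : J.HasLinearOrd f := by
  have hφ := fun s => map_ne_zero_iff (J.chart c) (J.chart_injective c) (x := s)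
  obtain ⟨s₀, t₀, ht₀, rfl⟩ := J.exists_eq_chart_div c f
  -- In lowest terms, a prime factor of numerator or denominator is a genuine zero or pole of `f`.
  -- It is thus a variable up to a unit, or its divisor misses the fixed point.
  obtain ⟨s, t, d, hrel, rfl, rfl⟩ := UniqueFactorizationMonoid.exists_reduced_factors' s₀ t₀ ht₀
  have hd := (hφ _).2 (left_ne_zero_of_mul ht₀)
  have ht := (hφ _).2 (right_ne_zero_of_mul ht₀)
  rw [map_mul, map_mul, mul_div_mul_left _ _ hd] at hf h ⊢
  have hs : J.chart c s ≠ 0 := (div_ne_zero_iff.1 hf).1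
  have hprime : ∀ q, Prime q → (q ∣ s ∨ q ∣ t) → J.HasLinearOrd (J.chart c q) := by
    intro q hq hqst
    by_cases hX : ∃ i, q ∣ MvPolynomial.X i
    · obtain ⟨i, hi⟩ := hX
      obtain ⟨u, hu⟩ := (hq.irreducible.associated_of_dvd
        (MvPolynomial.X_prime (i := i)).irreducible hi).symm
      rw [← hu, map_mul]
      refine .mul ((hφ _).2 (MvPolynomial.X_ne_zero i)) ((hφ _).2 u.ne_zero) ?_
        (hasLinearOrd_of_isUnit c u.isUnit)
      rw [chart_X]
      exact hasLinearOrd_chi _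
    · push Not at hX
      obtain ⟨E, hE⟩ := J.exists_divisorOver_of_prime c hq hX
      refine hasLinearOrd_of_center_not_le hσ c hX hE fun hle => ?_
      have h0 := h E q hX hE hle
      rw [E.ord_div hs ht] at h0
      rcases hqst with hd | hd
      · have h1 : ¬ q ∣ t := fun hd' => hq.not_isUnit (hrel hd hd')
        have h2 := hE.ord_pos_of_dvd ((hφ _).1 hs) hd
        have h3 := hE.ord_of_not_dvd h1
        omega
      · have h1 : ¬ q ∣ s := fun hd' => hq.not_isUnit (hrel hd' hd)
        have h2 := hE.ord_pos_of_dvd ((hφ _).1 ht) hd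
        have h3 := hE.ord_of_not_dvd h1
        omega
  have hall : ∀ a : MvPolynomial ι k, a ≠ 0 → (∀ q, Prime q → q ∣ a → q ∣ s ∨ q ∣ t) →
      J.HasLinearOrd (J.chart c a) := by
    intro a
    refine UniqueFactorizationMonoid.induction_on_prime a (fun h => absurd rfl h)
      (fun u hu _ _ => hasLinearOrd_of_isUnit c hu) fun a p ha hp ih _ hdvd => ?_
    rw [map_mul]
    exact .mul ((hφ _).2 hp.ne_zero) ((hφ _).2 ha) (hprime p hp (hdvd p hp (dvd_mul_right _ _)))
      (ih ha fun q hq hqa => hdvd q hq (hqa.mul_left _))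
  rw [div_eq_mul_inv]
  exact .mul hs (inv_ne_zero ht) (hall s ((hφ _).1 hs) fun q _ hq => Or.inl hq)
    (hall t ((hφ _).1 ht) fun q _ hq => Or.inr hq).inv

end LaurentEmbedding

/-! ### Logarithmic differentials -/

namespace LaurentEmbedding

variable {k : Type*} [Field k] {N : Type*} [AddCommGroup N] {σ : PointedCone ℝ (ℝ ⊗[ℤ] N)}
  (J : LaurentEmbedding k σ)

/-- The logarithmic differential of a character. -/
def dlog : Module.Dual ℤ N →+ Ω[FractionRing (toricRing k σ)⁄k] where
  toFun m := (J.chi m)⁻¹ • KaehlerDifferential.D k _ (J.chi m)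
  map_zero' := by simp
  map_add' m m' := by
    have h := J.chi_ne_zero m
    have h' := J.chi_ne_zero m'
    rw [chi_add, Derivation.leibniz, smul_add, smul_smul, smul_smul, add_comm]
    congr 2 <;> field_simp

lemma D_chi (m : Module.Dual ℤ N) :
    KaehlerDifferential.D k (FractionRing (toricRing k σ)) (J.chi m) = J.chi m • J.dlog m := by
  change _ = J.chi m • (J.chi m)⁻¹ • KaehlerDifferential.D k (FractionRing (toricRing k σ)) (J.chi m)
  rw [smul_smul, mul_inv_cancel₀ (J.chi_ne_zero m), one_smul]

variable {ι κ : Type*} [Fintype ι] [Fintype κ]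

lemma exists_basis_kaehler (c : Module.Basis ι ℤ (Module.Dual ℤ N)) :
    ∃ b : Module.Basis ι (FractionRing (toricRing k σ)) (Ω[FractionRing (toricRing k σ)⁄k]),
      ∀ i, b i = J.chi (c i) • J.dlog (c i) := by
  obtain ⟨b, hb⟩ := exists_basis_kaehler_fractionRing (J.chart c) (J.chart_injective c)
    (J.exists_eq_chart_div c)
  exact ⟨b, fun i => by rw [hb, chart_X, D_chi]⟩

include J in
lemma finrank_kaehler (c : Module.Basis ι ℤ (Module.Dual ℤ N)) :
    Module.finrank (FractionRing (toricRing k σ)) (Ω[FractionRing (toricRing k σ)⁄k]) =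
      Fintype.card ι := by
  obtain ⟨b, -⟩ := J.exists_basis_kaehler c
  exact Module.finrank_eq_card_basis b

variable [DecidableEq κ]
  (ω : Module.Basis κ (FractionRing (toricRing k σ)) (Ω[FractionRing (toricRing k σ)⁄k]))

lemma det_chi_smul_dlog (c : Module.Basis ι ℤ (Module.Dual ℤ N)) (e : κ ≃ ι) :
    (ω.det fun i => J.chi (c (e i)) • J.dlog (c (e i))) =
      (∏ i, J.chi (c i)) * ω.det fun i => J.dlog (c (e i)) := by
  rw [AlternatingMap.map_smul_univ, smul_eq_mul, ← e.prod_comp]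

lemma det_dlog_ne_zero (c : Module.Basis ι ℤ (Module.Dual ℤ N)) (e : κ ≃ ι) :
    (ω.det fun i => J.dlog (c (e i))) ≠ 0 := by
  obtain ⟨b, hb⟩ := J.exists_basis_kaehler c
  have h := (ω.isUnit_det (b.reindex e.symm)).ne_zero
  have h1 : (⇑(b.reindex e.symm)) = fun i => J.chi (c (e i)) • J.dlog (c (e i)) := by
    ext i; simp [hb]
  rw [h1, det_chi_smul_dlog] at h
  exact right_ne_zero_of_mul h

/-- The form `dlog χ₁ ∧ ⋯ ∧ dlog χ_d` does not depend on the lattice basis, up to sign. -/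
lemma det_dlog_eq (c c' : Module.Basis ι ℤ (Module.Dual ℤ N)) (e : κ ≃ ι) :
    ∃ z : ℤ, IsUnit z ∧ (ω.det fun i => J.dlog (c' (e i))) = z * ω.det fun i => J.dlog (c (e i)) := by
  classical
  let P : Matrix κ κ ℤ := Matrix.of fun i j => c.repr (c' (e i)) (e j)
  have hP : P = ((c.toMatrix c').transpose).submatrix e e := rfl
  refine ⟨P.det, ?_, ?_⟩
  · rw [hP, Matrix.det_submatrix_equiv_self, Matrix.det_transpose, ← c.det_apply]
    exact c.isUnit_det c'
  · have h := det_eq_det_mul ω (fun i => J.dlog (c (e i))) (fun i => J.dlog (c' (e i)))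
      ((Int.castRingHom (FractionRing (toricRing k σ))).mapMatrix P) fun i => by
        conv_lhs => rw [← c.sum_repr (c' (e i)), map_sum, ← e.sum_comp]
        refine Finset.sum_congr rfl fun j _ => ?_
        rw [map_zsmul]
        exact (Int.cast_smul_eq_zsmul _ _ _).symm
    rw [h, ← RingHom.map_det]
    rfl

end LaurentEmbedding

/-! ### Orders of rational forms in lattice charts -/

namespace LaurentEmbedding

variable {k : Type*} [Field k] {N : Type*} [AddCommGroup N] {σ : PointedCone ℝ (ℝ ⊗[ℤ] N)}
  (J : LaurentEmbedding k σ) {ι : Type*} [Fintype ι]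

/-- The order of a rational form along a divisor visible on a lattice chart, in terms of a fixed
lattice basis. -/
lemma hasFormOrd {E : DivisorOver (toricRing k σ)} {c : Module.Basis ι ℤ (Module.Dual ℤ N)}
    {q : MvPolynomial ι k} (hE : IsLocalizationAt E.localRing (J.chart c) q)
    (c₀ : Module.Basis ι ℤ (Module.Dual ℤ N)) (ω : RationalForm (toricRing k σ) k)
    (e : Fin (Module.finrank (FractionRing (toricRing k σ))
      (Ω[FractionRing (toricRing k σ)⁄k])) ≃ ι) :
    HasFormOrd E ω (- E.ord (ω.det fun i => J.dlog (c₀ (e i))) - ∑ i, E.ord (J.chi (c i))) := by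
  have h := hE.hasFormOrd ω e
  simp only [chart_X, D_chi] at h
  have hz1 : ∀ z : ℤ, IsUnit z → E.ord (z : FractionRing (toricRing k σ)) = 0 := fun z hz => by
    have := E.ord_coe_of_isUnit (hz.map (Int.castRingHom E.localRing))
    simpa using this
  obtain ⟨z, hz, hdet⟩ := J.det_dlog_eq ω c₀ c e
  have hz0 : (z : FractionRing (toricRing k σ)) ≠ 0 :=
    (hz.map (Int.castRingHom (FractionRing (toricRing k σ)))).ne_zero
  have hG := J.det_dlog_ne_zero ω c₀ e
  rw [det_chi_smul_dlog, hdet, E.ord_mul (Finset.prod_ne_zero_iff.2 fun i _ => J.chi_ne_zero _)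
    (mul_ne_zero hz0 hG), E.ord_mul hz0 hG, hz1 z hz, E.ord_prod _ _ fun i _ => J.chi_ne_zero _,
    zero_add, neg_add_rev, ← sub_eq_add_neg] at h
  exact h

end LaurentEmbedding

/-! ### Smooth cones give regular rings -/

section Regular

/-- The dual monoid is free on the dual basis, so the toric ring is a polynomial ring over a field.
-/
lemma isRegularRing_toricRing_of_basis (k : Type*) [Field k] {N : Type*} [AddCommGroup N]
    {σ : PointedCone ℝ (ℝ ⊗[ℤ] N)} {ι : Type*} [Finite ι] (b : Module.Basis ι ℤ N)
    (h : ∀ m : Module.Dual ℤ N, m ∈ dualMonoid σ ↔ ∀ i, 0 ≤ m (b i)) :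
    IsRegularRing (toricRing k σ) := by
  classical
  have := Fintype.ofFinite ι
  obtain ⟨c, hrepr⟩ : ∃ c : Module.Basis ι ℤ (Module.Dual ℤ N),
      ∀ (m : Module.Dual ℤ N) (i : ι), c.repr m i = m (b i) :=
    ⟨b.dualBasis, fun m i => by simp⟩
  let f : (ι →₀ ℕ) →+ dualMonoid σ := (exponentHom c).codRestrict (dualMonoid σ)
    fun u => (h _).2 fun i => by
      rw [← hrepr, repr_exponentHom]
      exact Int.natCast_nonneg _
  have hf : Function.Bijective f := by
    refine ⟨fun u u' huu => exponentHom_injective c (Subtype.ext_iff.1 huu),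
      fun m => ?_⟩
    obtain ⟨u, hu⟩ := (mem_range_exponentHom c (m := m.1)).2 fun i => by
      rw [hrepr]
      exact (h _).1 m.2 i
    exact ⟨u, Subtype.ext hu⟩
  let e : MvPolynomial ι k ≃ₐ[k] toricRing k σ :=
    AddMonoidAlgebra.domCongr k k (AddEquiv.ofBijective f hf)
  exact IsRegularRing.of_ringEquiv e.toRingEquiv

end Regular

/-! ### Nondegenerate cones -/

section FullDimensional

variable {N : Type*} [AddCommGroup N] [Module.Free ℤ N] [Module.Finite ℤ N]
  {σ : PointedCone ℝ (ℝ ⊗[ℤ] N)}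

omit [Module.Free ℤ N] [Module.Finite ℤ N] in
lemma eq_zero_of_realPairing_eq_zero {m : Module.Dual ℤ N} (h : realPairing m = 0) : m = 0 := by
  ext n
  have := LinearMap.congr_fun h (latticePoint n)
  rw [realPairing_latticePoint, LinearMap.zero_apply] at this
  rw [LinearMap.zero_apply]
  exact_mod_cast this

omit [Module.Free ℤ N] [Module.Finite ℤ N] in
lemma IsNondegenerate.eq_zero_of_forall {σ : PointedCone ℝ (ℝ ⊗[ℤ] N)} (hσ : IsNondegenerate σ)
    {m : Module.Dual ℤ N} (h : ∀ x ∈ σ, realPairing m x = 0) : m = 0 :=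
  eq_zero_of_realPairing_eq_zero (LinearMap.ext_on hσ fun x hx => h x hx)

omit [Module.Free ℤ N] [Module.Finite ℤ N] in
-- For a nondegenerate cone the dual monoid has no nonzero invertible elements, which is what the
-- torus-fixed point `origin` requires.
lemma IsNondegenerate.eq_zero_of_neg_mem (hσ : IsNondegenerate σ) (m : Module.Dual ℤ N)
    (hm : m ∈ dualMonoid σ) (hm' : -m ∈ dualMonoid σ) : m = 0 := by
  refine hσ.eq_zero_of_forall fun x hx => ?_
  have h1 : 0 ≤ realPairing m x := hm x hx
  have h2 : 0 ≤ realPairing (-m) x := hm' x hx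
  have h3 : realPairing (-m) x = - realPairing m x := by simp [realPairing]
  rw [h3] at h2
  linarith

omit [Module.Free ℤ N] [Module.Finite ℤ N] in
lemma eq_zero_of_eq_zero_on_generators (hσ : IsNondegenerate σ) {T : Finset N}
    (hT : σ = PointedCone.hull ℝ (latticePoint '' (T : Set N))) {m : Module.Dual ℤ N}
    (h : ∀ e ∈ T, m e = 0) : m = 0 := by
  refine hσ.eq_zero_of_forall fun x hx => ?_
  rw [hT] at hx
  obtain ⟨c, -, rfl⟩ := mem_hull_latticePoint.1 hx
  rw [realPairing_sum_smul]
  exact Finset.sum_eq_zero fun e he => by rw [h e he]; simp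

end FullDimensional

/-! ### Terminality and `ℚ`-factoriality in terms of lattice vectors -/

namespace LaurentEmbedding

variable {k : Type*} [Field k] {N : Type*} [AddCommGroup N]
  {σ : PointedCone ℝ (ℝ ⊗[ℤ] N)} {J : LaurentEmbedding k σ} {E : DivisorOver (toricRing k σ)}

/-- The `-1` is the simple pole of the logarithmic form along each toric divisor; the other term
compares that form with `ω`. -/
lemma IsToricDivisor.hasFormOrd {v : N} (hE : J.IsToricDivisor E v)
    (c₀ : Module.Basis (Fin 3) ℤ (Module.Dual ℤ N)) (ω : RationalForm (toricRing k σ) k)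
    (e : Fin (Module.finrank (FractionRing (toricRing k σ))
      (Ω[FractionRing (toricRing k σ)⁄k])) ≃ Fin 3) :
    HasFormOrd E ω (- E.ord (ω.det fun i => J.dlog (c₀ (e i))) - 1) := by
  have hchi := hE.ord_chi
  obtain ⟨c, h0, h, hE⟩ := hE
  have h1 := J.hasFormOrd hE c₀ ω e
  simp only [hchi, Fin.sum_univ_three, h0, h 1 (by decide), h 2 (by decide), add_zero] at h1
  exact h1

/-- Inverting the exposing character `χ^m` leaves the chart of the single ray of `e`, on which the
divisor is visible. -/
lemma IsToricDivisor.height_center_eq_one {T : Finset N}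
    (hT : σ = PointedCone.hull ℝ (latticePoint '' (T : Set N))) {e : N}
    (hE : J.IsToricDivisor E e) {m : Module.Dual ℤ N} (hme : m e = 0)
    (hm : ∀ e' ∈ T, e' ≠ e → 0 < m e') : E.center.asIdeal.height = 1 := by
  have hchi := hE.ord_chi
  obtain ⟨c, h0, h, hE⟩ := hE
  have hm' : ∀ e' ∈ T, 0 ≤ m e' := fun e' he' => by
    by_cases hne : e' = e
    · rw [hne, hme]
    · exact (hm e' he' hne).le
  refine LaurentEmbedding.height_center_eq_one hE ((mem_dualMonoid_iff hT).2 hm')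
    (by rw [hchi, hme]) fun u => exists_add_nsmul_mem_dualMonoid hT hm' fun e' he' h' => ?_
  by_cases hne : e' = e
  · rw [hne, ← repr_zero_eq h0 h, repr_exponentHom]
    exact Int.natCast_nonneg _
  · exact absurd h' (hm e' he' hne).ne'

/-- Such a divisor meets the torus, which is reached by inverting `χ^m₀`. -/
lemma height_center_eq_one_of_prime {T : Finset N}
    (hT : σ = PointedCone.hull ℝ (latticePoint '' (T : Set N))) {m₀ : Module.Dual ℤ N}
    (hm₀ : ∀ e ∈ T, 0 < m₀ e) {ι : Type*} {c : Module.Basis ι ℤ (Module.Dual ℤ N)}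
    {q : MvPolynomial ι k} (hE : IsLocalizationAt E.localRing (J.chart c) q)
    (hq : ∀ i, ¬ q ∣ MvPolynomial.X i) : E.center.asIdeal.height = 1 :=
  LaurentEmbedding.height_center_eq_one hE ((mem_dualMonoid_iff hT).2 fun e he => (hm₀ e he).le)
    (ord_chi_eq_zero hE hq _) fun _ => exists_add_nsmul_mem_dualMonoid hT
      (fun e he => (hm₀ e he).le) fun e he h => absurd h (hm₀ e he).ne'

variable [Module.Free ℤ N] [Module.Finite ℤ N]

/-- Terminality of `X_σ` in terms of lattice vectors: up to scaling there is a functional that is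
`1` on the generators of `σ` and greater than `1` on all other primitive vectors in `σ`. -/
theorem exists_functional_of_isTerminal (J : LaurentEmbedding k σ)
    (hN : Module.finrank ℤ N = 3) (hnd : IsNondegenerate σ) {T : Finset N}
    (hT : σ = PointedCone.hull ℝ (latticePoint '' (T : Set N))) (hgen : minimalGenerators σ = T)
    (hexp : ∀ e ∈ T, ∃ m : Module.Dual ℤ N, m e = 0 ∧ ∀ e' ∈ T, e' ≠ e → 0 < m e')
    {m₀ : Module.Dual ℤ N} (hm₀ : ∀ e ∈ T, 0 < m₀ e) (hterm : IsTerminal (toricRing k σ) k) :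
    ∃ (ψ : Module.Dual ℤ N) (r : ℤ), 0 < r ∧ (∀ e ∈ T, ψ e = r) ∧
      ∀ v, IsPrimitive v → latticePoint v ∈ σ → v ∉ T → r < ψ v := by
  obtain ⟨-, ω, K, hK, r, hr, hC, hdisc⟩ := hterm
  have hpt := hnd.eq_zero_of_neg_mem
  have hprim : ∀ e ∈ T, IsPrimitive e := fun e he => by
    have : e ∈ minimalGenerators σ := hgen ▸ he
    exact this.1
  let c₀ : Module.Basis (Fin 3) ℤ (Module.Dual ℤ N) :=
    Module.finBasisOfFinrankEq ℤ _ ((Module.finrank_linearMap_self ℤ ℤ N).trans hN)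
  let e := finCongr ((J.finrank_kaehler c₀).trans (Fintype.card_fin 3))
  let G := ω.det fun i => J.dlog (c₀ (e i))
  have hG : G ≠ 0 := J.det_dlog_ne_zero ω c₀ e
  obtain ⟨f, hf0, hf⟩ := hC (origin k hpt)
  have hordF : ∀ E : DivisorOver (toricRing k σ), E.ord (f * G ^ r) = E.ord f + r * E.ord G :=
    fun E => by rw [E.ord_mul hf0 (pow_ne_zero _ hG), E.ord_pow]
  -- `ω` is `G⁻¹` times the logarithmic form, so `f * G ^ r` is a local equation at the fixed point
  -- of `r` times the divisor of that form. It has order zero along nontoric prime divisors and `-r`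
  -- along those of the generators.
  obtain ⟨l, hl⟩ := hasLinearOrd_of_ord_eq_zero (J := J) hpt c₀ (f := f * G ^ r)
    (mul_ne_zero hf0 (pow_ne_zero _ hG)) fun E q hq hE hle => by
      have h1 := hf ⟨E, height_center_eq_one_of_prime hT hm₀ hE hq⟩ hle
      have h2 := (hK ⟨E, height_center_eq_one_of_prime hT hm₀ hE hq⟩).unique
        (J.hasFormOrd hE c₀ ω e)
      simp only [ord_chi_eq_zero hE hq, Finset.sum_const_zero, sub_zero] at h2
      dsimp only at h1
      rw [hordF, h1, h2]
      ring
  refine ⟨-l, r, by exact_mod_cast hr, fun a ha => ?_, fun v hv hvσ hvT => ?_⟩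
  · obtain ⟨E, hE⟩ := J.exists_isToricDivisor hN (hprim a ha) (latticePoint_mem_of_mem hT ha)
    obtain ⟨m, hma, hm⟩ := hexp a ha
    have hht := hE.height_center_eq_one hT hma hm
    have h1 := hf ⟨E, hht⟩ (hE.center_le_origin hpt)
    have h2 := (hK ⟨E, hht⟩).unique (hE.hasFormOrd c₀ ω e)
    have h3 := hl E a hE
    dsimp only at h1
    rw [hordF, h1, h2] at h3
    rw [LinearMap.neg_apply, ← h3]
    ring
  · obtain ⟨E, hE⟩ := J.exists_isToricDivisor hN hv hvσ
    obtain ⟨a, ha, hle, m₁, hm₁, h1a, h1v⟩ := exists_generator_of_notMem hT hgen hexp hv hvσ hvT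
    obtain ⟨E', hE'⟩ := J.exists_isToricDivisor hN (hprim a ha) (latticePoint_mem_of_mem hT ha)
    have hexc := hE.isExceptional hE' hvσ
      ((mem_dualMonoid_iff hT).2 fun e he => (hm₀ e he).le) (hm₀ a ha) hle hm₁ h1a h1v
    have h1 := hdisc E hexc f ⟨hf0, fun D hD => hf D (hD.trans (hE.center_le_origin hpt))⟩ _
      (hE.hasFormOrd c₀ ω e)
    have h2 := hl E v hE
    rw [hordF] at h2
    have h3 : (E.ord f : ℚ) = l v - r * E.ord G := by
      rw [← h2]; push_cast; ring
    have hrQ : (0 : ℚ) < r := by exact_mod_cast hr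
    -- The contribution of `G` cancels: the discrepancy of `E` is `-(l v) / r - 1`.
    rw [h3, sub_div, mul_div_cancel_left₀ _ hrQ.ne'] at h1
    change 0 < ((-E.ord G - 1 : ℤ) : ℚ) - _ at h1
    push_cast at h1
    have h4 : (l v : ℚ) / r < -1 := by linarith
    rw [div_lt_iff₀ hrQ] at h4
    have h5 : (r : ℚ) < -(l v : ℚ) := by linarith
    rw [LinearMap.neg_apply]
    exact_mod_cast h5

/-- If `X_σ` is `ℚ`-factorial, then the generators of `σ` are linearly independent. -/
theorem exists_functional_of_isQFactorial (J : LaurentEmbedding k σ)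
    (hN : Module.finrank ℤ N = 3) (hnd : IsNondegenerate σ) {T : Finset N}
    (hT : σ = PointedCone.hull ℝ (latticePoint '' (T : Set N))) (hgen : minimalGenerators σ = T)
    (hexp : ∀ e ∈ T, ∃ m : Module.Dual ℤ N, m e = 0 ∧ ∀ e' ∈ T, e' ≠ e → 0 < m e')
    {m₀ : Module.Dual ℤ N} (hm₀ : ∀ e ∈ T, 0 < m₀ e) (hQ : IsQFactorial (toricRing k σ))
    {a : N} (ha : a ∈ T) :
    ∃ l : Module.Dual ℤ N, l a ≠ 0 ∧ ∀ b ∈ T, b ≠ a → l b = 0 := by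
  have hpt := hnd.eq_zero_of_neg_mem
  have hprim : ∀ e ∈ T, IsPrimitive e := fun e he => by
    have : e ∈ minimalGenerators σ := hgen ▸ he
    exact this.1
  let c₀ : Module.Basis (Fin 3) ℤ (Module.Dual ℤ N) :=
    Module.finBasisOfFinrankEq ℤ _ ((Module.finrank_linearMap_self ℤ ℤ N).trans hN)
  obtain ⟨Ea, hEa⟩ := J.exists_isToricDivisor hN (hprim a ha) (latticePoint_mem_of_mem hT ha)
  obtain ⟨ma, hma, hma'⟩ := hexp a ha
  let Da : PrimeDivisor (toricRing k σ) := ⟨Ea, hEa.height_center_eq_one hT hma hma'⟩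
  obtain ⟨r, hr, hC⟩ := hQ.2 (Finsupp.single Da 1)
  obtain ⟨f, hf0, hf⟩ := hC (origin k hpt)
  -- A prime divisor is shown to differ from `Da` by the order of one character: `m₀` for the
  -- nontoric ones, `ma` for the other generators.
  have hfD : ∀ D : PrimeDivisor (toricRing k σ), D.1.center.asIdeal ≤ (origin k hpt).asIdeal →
      ∀ m, D.1.ord (J.chi m) ≠ Ea.ord (J.chi m) → D.1.ord f = 0 := fun D hD m hm => by
    rw [hf D hD, Finsupp.smul_apply, Finsupp.single_eq_of_ne, smul_zero]
    rintro rfl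
    exact hm rfl
  obtain ⟨l, hl⟩ := hasLinearOrd_of_ord_eq_zero (J := J) hpt c₀ hf0 fun E q hq hE hle =>
    hfD ⟨E, height_center_eq_one_of_prime hT hm₀ hE hq⟩ hle m₀ (by
      rw [ord_chi_eq_zero hE hq, hEa.ord_chi]
      exact (hm₀ a ha).ne)
  refine ⟨l, ?_, fun b hb hba => ?_⟩
  · rw [← hl Ea a hEa, hf Da (hEa.center_le_origin hpt)]
    simpa using hr.ne'
  · obtain ⟨E, hE⟩ := J.exists_isToricDivisor hN (hprim b hb) (latticePoint_mem_of_mem hT hb)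
    obtain ⟨m, hmb, hm⟩ := hexp b hb
    rw [← hl E b hE]
    refine hfD ⟨E, hE.height_center_eq_one hT hmb hm⟩ (hE.center_le_origin hpt) ma ?_
    rw [hE.ord_chi, hEa.ord_chi, hma]
    exact (hma' b hb hba).ne'

end LaurentEmbedding

/-! ### Maximal cones of a moderate resolution -/

section Moderate

variable {N : Type*} [AddCommGroup N] [Module.Free ℤ N] [Module.Finite ℤ N]

/-- In a nondegenerate smooth cone the generators form a lattice basis. -/
lemma IsSmoothCone.exists_basis {τ : PointedCone ℝ (ℝ ⊗[ℤ] N)} (hτ : IsSmoothCone τ)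
    (hnd : IsNondegenerate τ) (hlat : IsLatticeCone τ) :
    ∃ b : Module.Basis (Fin (Module.finrank ℤ N)) ℤ N, minimalGenerators τ = Set.range b := by
  obtain ⟨b, hb⟩ := hτ
  obtain ⟨T, hgen, hT, -⟩ := hlat.exists_generators
  refine ⟨b, hb.antisymm ?_⟩
  rintro _ ⟨i, rfl⟩
  by_contra hi
  -- If `b i` were not a generator, its coordinate functional would vanish on all of `τ`, which
  -- spans the space.
  have h0 : b.coord i = 0 := eq_zero_of_eq_zero_on_generators hnd hT fun e he => by
    have heg : e ∈ minimalGenerators τ := hgen ▸ he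
    obtain ⟨j, rfl⟩ := hb heg
    have hji : j ≠ i := by
      rintro rfl
      exact hi heg
    simp [hji]
  have := LinearMap.congr_fun h0 (b i)
  simp at this

omit [Module.Free ℤ N] [Module.Finite ℤ N] in
lemma realPairing_eq_of_mem_affineSpan {m : Module.Dual ℤ N} {z : ℝ} {s : Set N}
    (h : ∀ e ∈ s, (m e : ℝ) = z) {x : ℝ ⊗[ℤ] N}
    (hx : x ∈ affineSpan ℝ (latticePoint '' s)) : realPairing m x = z := by
  refine affineSpan_induction (p := fun x => realPairing m x = z) hx ?_ ?_
  · rintro _ ⟨e, he, rfl⟩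
    rw [realPairing_latticePoint, h e he]
  · intro c u v w hu hv hw
    rw [vsub_eq_sub, vadd_eq_add, map_add, map_smul, map_sub, hu, hv, hw]
    simp

lemma isRayOf_of_mem_minimalGenerators {σ : PointedCone ℝ (ℝ ⊗[ℤ] N)} {e : N}
    (he : e ∈ minimalGenerators σ) : IsRayOf (PointedCone.hull ℝ {latticePoint e}) σ := by
  refine ⟨he.2, ?_⟩
  have h : Submodule.span ℝ ((PointedCone.hull ℝ {latticePoint e} : PointedCone ℝ (ℝ ⊗[ℤ] N)) :
      Set (ℝ ⊗[ℤ] N)) = Submodule.span ℝ {latticePoint e} := by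
    refine le_antisymm (Submodule.span_le.2 fun x hx => ?_)
      (Submodule.span_mono (Submodule.subset_span))
    obtain ⟨c, -, rfl⟩ := mem_hull_singleton.1 hx
    exact Submodule.smul_mem _ _ (Submodule.subset_span rfl)
  rw [h]
  exact finrank_span_singleton (latticePoint_ne_zero he.1.ne_zero)

/-- The generators of a maximal cone of a moderate resolution are generators of `σ` if all other
primitive vectors of `σ` lie beyond the hyperplane through the generators of `σ`. -/
lemma IsModerateToricResolution.minimalGenerators_subset {F : Set (PointedCone ℝ (ℝ ⊗[ℤ] N))}
    {σ : PointedCone ℝ (ℝ ⊗[ℤ] N)} (hF : IsModerateToricResolution F σ) {T : Finset N}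
    (hT : σ = PointedCone.hull ℝ (latticePoint '' (T : Set N))) (hgen : minimalGenerators σ = T)
    {ψ : Module.Dual ℤ N} {r : ℤ} (hr : 0 < r) (hψ : ∀ e ∈ T, ψ e = r)
    (hψ' : ∀ v, IsPrimitive v → latticePoint v ∈ σ → v ∉ T → r < ψ v)
    {τ : PointedCone ℝ (ℝ ⊗[ℤ] N)} (hτ : τ ∈ F) (hnd : IsNondegenerate τ) :
    minimalGenerators τ ⊆ minimalGenerators σ := by
  obtain ⟨b, hb⟩ := (hF.smooth τ hτ hnd).exists_basis hnd (hF.isSubdivision.1.isLatticeCone τ hτ)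
  let l : Module.Dual ℤ N := ∑ i, b.coord i
  have hl : ∀ e ∈ minimalGenerators τ, l e = 1 := by
    rw [hb]
    rintro _ ⟨i, rfl⟩
    simp [l, Finsupp.single_apply]
  have hlT : ∀ e ∈ T, 1 ≤ l e := fun e he => by
    have heg : e ∈ minimalGenerators σ := hgen ▸ he
    obtain ⟨x, hx, hxe⟩ := hF.hyperplane_meets τ hτ hnd _ (isRayOf_of_mem_minimalGenerators heg)
    have h1 : realPairing l x = 1 :=
      realPairing_eq_of_mem_affineSpan (fun e he => by exact_mod_cast hl e he) hx
    obtain ⟨c, hc, rfl⟩ := mem_hull_singleton.1 hxe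
    rw [map_smul, realPairing_latticePoint, smul_eq_mul] at h1
    -- The hyperplane `l = 1` meets the ray of `e`; integrality improves `0 < l e` to `1 ≤ l e`.
    have h2 : (0 : ℝ) < l e := by
      by_contra h
      have := mul_nonpos_of_nonneg_of_nonpos hc (not_lt.1 h)
      linarith
    exact_mod_cast h2
  intro f hf
  have hfσ : latticePoint f ∈ σ := by
    have h1 : latticePoint f ∈ (⋃ τ ∈ F, (τ : Set (ℝ ⊗[ℤ] N))) :=
      Set.mem_iUnion₂.2 ⟨τ, hτ, hf.2.le (Submodule.subset_span rfl)⟩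
    rw [hF.isSubdivision.2] at h1
    exact h1
  rw [hgen]
  by_contra hfT
  have h1 := hψ' f hf.1 hfσ hfT
  have hfσ' := hfσ
  rw [hT, mem_hull_latticePoint] at hfσ'
  obtain ⟨c, hc, hsum⟩ := hfσ'
  have h2 : (ψ f : ℝ) = ∑ e ∈ T, c e * r := by
    rw [← realPairing_latticePoint, hsum, realPairing_sum_smul]
    exact Finset.sum_congr rfl fun e he => by rw [hψ e he]
  have h3 : (1 : ℝ) = ∑ e ∈ T, c e * l e := by
    rw [← realPairing_sum_smul, ← hsum, realPairing_latticePoint, hl f hf, Int.cast_one]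
  have h4 : ∑ e ∈ T, c e ≤ 1 := by
    rw [h3]
    refine Finset.sum_le_sum fun e he => le_mul_of_one_le_right (hc e) ?_
    exact_mod_cast hlT e he
  have h5 : (ψ f : ℝ) ≤ r := by
    rw [h2, ← Finset.sum_mul]
    exact mul_le_of_le_one_left (by exact_mod_cast hr.le) h4
  have h6 : ψ f ≤ r := by exact_mod_cast h5
  omega

end Moderate

end ToricModerate

end

open scoped TensorProduct

theorem corollary3p4 (k : Type*) [Field k]
    (N : Type*) [AddCommGroup N] [Module.Free ℤ N] [Module.Finite ℤ N]
    (hN : Module.finrank ℤ N = 3)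
    (σ : PointedCone ℝ (ℝ ⊗[ℤ] N)) (hσ : ToricModerate.IsLatticeCone σ)
    (hterminal : ToricModerate.IsTerminal (ToricModerate.toricRing k σ) k)
    (hQfactorial : ToricModerate.IsQFactorial (ToricModerate.toricRing k σ))
    (hsingular : ToricModerate.IsSingular (ToricModerate.toricRing k σ)) :
    ¬ ∃ F : Set (PointedCone ℝ (ℝ ⊗[ℤ] N)), ToricModerate.IsModerateToricResolution F σ := by
  open ToricModerate in
  rintro ⟨F, hF⟩
  have hnd := hF.nondegenerate
  obtain ⟨T, hgen, hT, hexp, m₀, hm₀⟩ := hσ.exists_generators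
  obtain ⟨J⟩ := exists_laurentEmbedding k ((mem_dualMonoid_iff hT).2 fun e he => (hm₀ e he).le)
    fun a => exists_add_nsmul_mem_dualMonoid hT (fun e he => (hm₀ e he).le)
      fun e he h => absurd h (hm₀ e he).ne'
  obtain ⟨ψ, r, hr, hψ, hψ'⟩ :=
    J.exists_functional_of_isTerminal hN hnd hT hgen hexp hm₀ hterminal
  obtain ⟨τ, hτ, hτnd⟩ := hF.isSubdivision.exists_isNondegenerate hnd
  have hsub := hF.minimalGenerators_subset hT hgen hr hψ hψ' hτ hτnd
  obtain ⟨b, hb⟩ := (hF.smooth τ hτ hτnd).exists_basis hτnd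
    (hF.isSubdivision.1.isLatticeCone τ hτ)
  rw [hb, hgen] at hsub
  -- A generator outside the basis would be separated from all basis vectors by a functional, which
  -- vanishes on the basis and hence everywhere.
  have hTb : ∀ e ∈ T, e ∈ Set.range b := fun e he => by
    by_contra hne
    obtain ⟨l, hle, hl⟩ :=
      J.exists_functional_of_isQFactorial hN hnd hT hgen hexp hm₀ hQfactorial he
    have h0 : l = 0 := b.ext fun i => by
      rw [hl (b i) (hsub ⟨i, rfl⟩) fun h => hne ⟨i, h⟩, LinearMap.zero_apply]
    exact hle (by rw [h0, LinearMap.zero_apply])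
  refine hsingular (isRegularRing_toricRing_of_basis k b fun m => ?_)
  rw [mem_dualMonoid_iff hT]
  refine ⟨fun h i => h _ (hsub ⟨i, rfl⟩), fun h e he => ?_⟩
  obtain ⟨i, rfl⟩ := hTb e he
  exact h i
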